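/- Let $1\le k\le d$ be integers and let $M\subset\mathbb R^d$ be a smooth ($C^\infty$) embedded submanifold of dimension $k$. All distances, balls and neighborhoods in $\mathbb R^d$ and $\mathbb R^k$ are taken with respect to the max norm. **The exponent.** Put $[n,m]=\binom{n+m}{m}$. Let $n_{k,d}\ge 0$ be the largest integer such that $d=[k-1,1]+[k-1,2]+\dots+[k-1,n_{k,d}]+m_{k,d}$ for some integer $m_{k,d}\ge0$, let $m_{k,d}$ be defined by this equation, and let $$N_{k,d}=1[k-1,1]+2[k-1,2]+\dots+n_{k,d}[k-1,n_{k,d}]+(n_{k,d}+1)m_{k,d},\qquad c(k,d)=\frac{d+1}{N_{k,d}}.$$ **Badly approximable points.** Write $\psi_c(t)=t^{-c}$, and for $\mathbf r=\mathbf p/q\in\mathbb Q^d$ in reduced form ($\mathbf p\in\mathbb Z^d$, $q\in\mathbb N$) write $H(\mathbf r)=q$. Let $\mathrm{BA}_M(\psi)$ be the set of $\mathbf x\in M$ for which there is $c_{\mathbf x}>0$ with $\mathrm{dist}(\mathbf x,\mathbf r)\ge c_{\mathbf x}\,\psi(H(\mathbf r))$ for all $\mathbf r\in\mathbb Q^d\cap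 M$. **Nondegeneracy.** A local parameterization of $M$ is a smooth immersion $\Psi:U\to M$, with $U\subset\mathbb R^k$ open, that is a homeomorphism onto a relatively open subset of $M$. For $D\in\mathbb N$, a point $\mathbf x\in M$ is $D$-nondegenerate for $M$ if, for a local parameterization $\Phi:U\to M$ and $\mathbf v\in U$ with $\Phi(\mathbf v)=\mathbf x$, the partial derivatives $\partial^\alpha\Phi(\mathbf v)$, $\alpha\in\mathbb Z_{\ge 0}^k$, $0<|\alpha|\le D$, span $\mathbb R^d$ (this does not depend on the choice of $\Phi$). **The game.** For $\beta>0$, in the $\beta$-hyperplane game on $\mathbb R^k$ Bob chooses a closed ball $B_0=B(\mathbf x_0,\rho_0)$; after Bob's ball $B_n=B(\mathbf x_n,\rho_n)$ Alice chooses an affine hyperplane $A_n\subset\mathbb R^k$, and then Bob must choose a closed ball $B_{n+1}=B(\mathbf x_{n+1},\rho_{n+1})$ with $B_{n+1}\subset B_n\setminus A_n^{(\beta\rho_n)}$ and $\rho_{n+1}\ge\beta\rho_n$, where $A^{(\epsilon)}$ is the closed $\epsilon$-neighborhood of $A$ and all radii are positive. If he cannot, he loses. A set $S\subset\mathbb R^k$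 is hyperplane absolute winning if for every $\beta>0$ Alice has a strategy which guarantees that either Bob loses in this way or $\bigcap_n B_n\cap S\ne\emptyset$. A set $S\subset M$ is hyperplane absolute winning relative to $M$ if for every local parameterization $\Psi:U\to M$ and every compact $K\subset U$ the set $\Psi^{-1}(S)\cup(\mathbb R^k\setminus K)$ is hyperplane absolute winning. **Theorem.** Suppose that for some $D\in\mathbb N$ every point of $M$ is $D$-nondegenerate. Then $\mathrm{BA}_M(\psi_{c(k,d)})$ is hyperplane absolute winning relative to $M$. -/

import Mathlib

open scoped ContDiff

namespace IntrinsicApprox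

noncomputable section

/-! Throughout, `Fin n → ℝ` is `ℝⁿ` with the max norm, which is its norm in Mathlib. -/

/-! ### The exponent `c(k,d)` -/

/-- `[n,m]`, the binomial coefficient `(n + m)` choose `m`. -/
def brk (n m : ℕ) : ℕ := (n + m).choose m

/-- `n_{k,d}`: the largest `n` with `[k-1,1] + [k-1,2] + ⋯ + [k-1,n] ≤ d`.
All summands are at least `1`, so any such `n` is at most `d`. -/
def nkd (k d : ℕ) : ℕ :=
  Nat.findGreatest (fun n => ∑ j ∈ Finset.Icc 1 n, brk (k - 1) j ≤ d) d

theorem isGreatest_nkd (k d : ℕ) :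
    IsGreatest {n | ∑ j ∈ Finset.Icc 1 n, brk (k - 1) j ≤ d} (nkd k d) := by
  constructor
  · exact Nat.findGreatest_spec (P := fun n => ∑ j ∈ Finset.Icc 1 n, brk (k - 1) j ≤ d)
      (Nat.zero_le d) (by simp)
  · intro n hn
    refine Nat.le_findGreatest ?_ hn
    have h1 : ∑ j ∈ Finset.Icc 1 n, 1 ≤ ∑ j ∈ Finset.Icc 1 n, brk (k - 1) j :=
      Finset.sum_le_sum fun j _ => Nat.choose_pos (by omega)
    have h2 : ∑ j ∈ Finset.Icc 1 n, brk (k - 1) j ≤ d := hn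
    simp at h1
    omega

/-- `m_{k,d} = d - ([k-1,1] + ⋯ + [k-1,n_{k,d}])`, a difference that is not truncated. -/
def mkd (k d : ℕ) : ℕ := d - ∑ j ∈ Finset.Icc 1 (nkd k d), brk (k - 1) j

/-- `N_{k,d} = 1[k-1,1] + 2[k-1,2] + ⋯ + n_{k,d}[k-1,n_{k,d}] + (n_{k,d} + 1) m_{k,d}`. -/
def Nkd (k d : ℕ) : ℕ :=
  ∑ j ∈ Finset.Icc 1 (nkd k d), j * brk (k - 1) j + (nkd k d + 1) * mkd k d

/-- `c(k,d) = (d + 1) / N_{k,d}`. -/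
def cExp (k d : ℕ) : ℝ := ((d : ℝ) + 1) / (Nkd k d : ℝ)

/-! ### Submanifolds of `ℝ^d` and nondegeneracy -/

/-- `Ψ : U → M` is a local parameterization of `M ⊆ ℝ^d` by an open subset `U` of `ℝ^k`: a smooth
immersion that is a homeomorphism of `U` onto a relatively open subset of `M`. (The values of `Ψ`
outside of `U` play no role.) -/
structure IsLocalParam {k d : ℕ} (M : Set (Fin d → ℝ)) (U : Set (Fin k → ℝ))
    (Ψ : (Fin k → ℝ) → (Fin d → ℝ)) : Prop where
  isOpen_domain : IsOpen U
  contDiffOn : ContDiffOn ℝ ∞ Ψ U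
  injective_fderiv : ∀ u ∈ U, Function.Injective (fderiv ℝ Ψ u)
  isEmbedding : Topology.IsEmbedding (U.domRestrict Ψ)
  image_relatively_open : ∃ O : Set (Fin d → ℝ), IsOpen O ∧ Ψ '' U = M ∩ O

/-- `M` is a (smooth, embedded) submanifold of `ℝ^d` of dimension `k`. -/
def IsSubmanifold (k : ℕ) {d : ℕ} (M : Set (Fin d → ℝ)) : Prop :=
  ∀ x ∈ M, ∃ (U : Set (Fin k → ℝ)) (Φ : (Fin k → ℝ) → (Fin d → ℝ)),
    IsLocalParam M U Φ ∧ x ∈ Φ '' U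

/-- The span of the partial derivatives `∂^α Φ(v)` with `0 < |α| ≤ D`. A partial derivative of
order `i` is written as the `i`-th derivative evaluated at standard basis vectors
`e_{s 0}, …, e_{s (i-1)}`. -/
def partialsSpan {k d : ℕ} (Φ : (Fin k → ℝ) → (Fin d → ℝ)) (v : Fin k → ℝ) (D : ℕ) :
    Submodule ℝ (Fin d → ℝ) :=
  Submodule.span ℝ {y | ∃ i : ℕ, 0 < i ∧ i ≤ D ∧ ∃ s : Fin i → Fin k,
    y = iteratedFDeriv ℝ i Φ v (fun l => Pi.single (s l) (1 : ℝ))}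

/-- The point `x` of the `k`-dimensional submanifold `M` is `D`-nondegenerate: the tangent space of
order `D` of `M` at `x`, computed in a local parameterization, is all of `ℝ^d`. (The tangent space
of order `D` does not depend on the local parameterization.) -/
def IsNondegenerateAt (k : ℕ) {d : ℕ} (M : Set (Fin d → ℝ)) (D : ℕ) (x : Fin d → ℝ) : Prop :=
  ∃ (U : Set (Fin k → ℝ)) (Φ : (Fin k → ℝ) → (Fin d → ℝ)) (v : Fin k → ℝ),
    IsLocalParam M U Φ ∧ v ∈ U ∧ Φ v = x ∧ partialsSpan Φ v D = ⊤

/-! ### Badly intrinsically approximable points -/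

/-- A rational point, seen as a point of `ℝ^d`. -/
def ratPoint {d : ℕ} (r : Fin d → ℚ) : Fin d → ℝ := fun i => (r i : ℝ)

/-- The height `H(p/q) = q` of a rational point written in reduced form: the reduced common
denominator of the coordinates. -/
def height {d : ℕ} (r : Fin d → ℚ) : ℕ := Finset.univ.lcm (fun i => (r i).den)

/-- `ψ_c(t) = 1 / t^c`. -/
def psi (c t : ℝ) : ℝ := 1 / t ^ c

/-- `BA_M(ψ)`: the points of `M` that are `ψ`-badly approximable by the rational points of `M`. -/
def BA {d : ℕ} (M : Set (Fin d → ℝ)) (ψ : ℝ → ℝ) : Set (Fin d → ℝ) :=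
  {x | x ∈ M ∧ ∃ c : ℝ, 0 < c ∧
    ∀ r : Fin d → ℚ, ratPoint r ∈ M → c * ψ (height r : ℝ) ≤ dist x (ratPoint r)}

/-! ### The hyperplane (absolute) game on `ℝ^k` -/

/-- Affine hyperplanes of `ℝ^k`. -/
def IsAffineHyperplane {k : ℕ} (A : Set (Fin k → ℝ)) : Prop :=
  ∃ (a : Fin k → ℝ) (b : ℝ), a ≠ 0 ∧ A = {x | ∑ i, a i * x i = b}

/-- The set of points of a closed ball that is given by its center and its radius. -/
def ballSet {k : ℕ} (B : (Fin k → ℝ) × ℝ) : Set (Fin k → ℝ) := Metric.closedBall B.1 B.2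

/-- A strategy of Alice: after Bob's moves `B_0, …, B_n` she chooses an affine hyperplane. -/
def Strategy (k : ℕ) : Type :=
  (n : ℕ) → (Fin (n + 1) → (Fin k → ℝ) × ℝ) → {A : Set (Fin k → ℝ) // IsAffineHyperplane A}

/-- `B_0, B_1, …` is an infinite run of legal moves of Bob in the `β`-hyperplane game in which Alice
plays `A_n = σ(B_0, …, B_n)`: all radii are positive, `B_{n+1} ⊆ B_n ∖ A_n^{(β ρ_n)}` and
`ρ_{n+1} ≥ β ρ_n`. -/
def IsPlay {k : ℕ} (β : ℝ) (σ : Strategy k) (B : ℕ → (Fin k → ℝ) × ℝ) : Prop :=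
  (∀ n, 0 < (B n).2) ∧
  ∀ n, ballSet (B (n + 1)) ⊆
      ballSet (B n) \ Metric.cthickening (β * (B n).2) (σ n (fun i => B i)).1 ∧
    β * (B n).2 ≤ (B (n + 1)).2

/-- `S` is `β`-hyperplane winning: Alice has a strategy such that in every infinite run of the game
the intersection of Bob's balls meets `S`. (Runs in which Bob gets stuck are won by Alice.) -/
def IsBetaHyperplaneWinning {k : ℕ} (β : ℝ) (S : Set (Fin k → ℝ)) : Prop :=
  ∃ σ : Strategy k, ∀ B : ℕ → (Fin k → ℝ) × ℝ, IsPlay β σ B →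
    ((⋂ n, ballSet (B n)) ∩ S).Nonempty

/-- `S ⊆ ℝ^k` is hyperplane (absolute) winning. -/
def IsHyperplaneWinning {k : ℕ} (S : Set (Fin k → ℝ)) : Prop :=
  ∀ β : ℝ, 0 < β → IsBetaHyperplaneWinning β S

/-- `S` is hyperplane (absolute) winning relative to the `k`-dimensional submanifold `M`: for each
local parameterization `Ψ : U → M` and each compact `K ⊆ U`, the set `Ψ⁻¹(S) ∪ (ℝ^k ∖ K)` is
hyperplane winning. -/
def IsHyperplaneWinningRel (k : ℕ) {d : ℕ} (M S : Set (Fin d → ℝ)) : Prop :=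
  ∀ (U : Set (Fin k → ℝ)) (Ψ : (Fin k → ℝ) → (Fin d → ℝ)), IsLocalParam M U Ψ →
    ∀ K : Set (Fin k → ℝ), IsCompact K → K ⊆ U → IsHyperplaneWinning ((U ∩ Ψ ⁻¹' S) ∪ Kᶜ)

end

end IntrinsicApprox

namespace IntrinsicApprox

/-! Everything rests on a simplex lemma in the parameter space. Take `d + 1` rational points of `M`
with parameters in a ball of radius `ρ`, and form the matrix of rows `(1, r)`. Clearing denominators
shows that its determinant is either zero or at least the inverse of the product of the heights.
Conversely, expand each row in monomials of degree at most `nkd k d` plus a remainder of order one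
more. By multilinearity the determinant is a sum of determinants, and those using one monomial twice
vanish. The cheapest surviving choice takes each monomial once and fills the other `mkd k d` rows
with remainders, which gives a bound of order `ρ ^ Nkd k d` (`le_sum_rowDeg`, `abs_det_taylor_le`).
So the points of height below a constant times `ρ ^ (-N / (d + 1))` lie on one affine hyperplane
(`exists_const_rational_points_on_hyperplane`); this is where the exponent comes from.

In parameters, that hyperplane becomes the zero set of `f = b + ∑ a_l Ψ_l`, which is curved, whereas
Alice may delete only neighborhoods of hyperplanes. By nondegeneracy and compactness some derivative
of `f` of order between 1 and `D` is bounded below. Alice deletes the zero set of the linearization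
of the derivative one order lower, which bounds that one below on a smaller ball, and so descends to
`f` itself (`exists_force_abs_ge`, `exists_force_avoid_zeros`). The number of rounds is independent
of the hyperplane.

Alice repeats this in blocks of fixed length. The radii at the block ends tend to zero with ratios
bounded below, so every height is handled at a scale comparable to or larger than the required
distance (`exists_scale`). -/

/-! ### Forcing a position in the hyperplane game -/

/-- Bob's ball `B'` is a legal answer to Alice's hyperplane `A` in the position `B`. -/
def Reply {k : ℕ} (β : ℝ) (A : Set (Fin k → ℝ)) (B B' : (Fin k → ℝ) × ℝ) : Prop :=
  0 < B'.2 ∧ ballSet B' ⊆ ballSet B \ Metric.cthickening (β * B.2) A ∧ β * B.2 ≤ B'.2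

/-- Alice can force that Bob's ball after exactly `m` further rounds satisfies `P`. -/
def Force {k : ℕ} (β : ℝ) (P : (Fin k → ℝ) × ℝ → Prop) : ℕ → (Fin k → ℝ) × ℝ → Prop
  | 0, B => P B
  | m + 1, B => ∃ A, IsAffineHyperplane A ∧ ∀ B', Reply β A B B' → Force β P m B'

section Force

variable {k : ℕ} {β : ℝ} {P Q : (Fin k → ℝ) × ℝ → Prop} {B : (Fin k → ℝ) × ℝ}

theorem isAffineHyperplane_coord (i : Fin k) (b : ℝ) :
    IsAffineHyperplane {u : Fin k → ℝ | u i = b} := by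
  refine ⟨Pi.single i 1, b, ?_, ?_⟩
  · intro h
    simpa using congrFun h i
  · ext u
    simp [Pi.single_apply]

theorem Force.mono {m : ℕ} (h : Force β P m B) (hPQ : ∀ B', P B' → Q B') : Force β Q m B := by
  induction m generalizing B with
  | zero => exact hPQ _ h
  | succ m ih =>
    obtain ⟨A, hA, h⟩ := h
    exact ⟨A, hA, fun B' hB' => ih (h B' hB')⟩

theorem Force.bind {a b : ℕ} (h : Force β (fun B' => Force β Q b B') a B) :
    Force β Q (a + b) B := by
  induction a generalizing B with
  | zero => simpa [Force] using h
  | succ a ih =>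
    obtain ⟨A, hA, h⟩ := h
    rw [Nat.succ_add]
    exact ⟨A, hA, fun B' hB' => ih (h B' hB')⟩

theorem Reply.subset {A : Set (Fin k → ℝ)} {B' : (Fin k → ℝ) × ℝ} (h : Reply β A B B') :
    ballSet B' ⊆ ballSet B := fun _ hu => (h.2.1 hu).1

theorem Force.and_bounds {m : ℕ} (hβ : 0 < β) (h : Force β P m B) (hB : 0 < B.2) :
    Force β (fun B' => P B' ∧ ballSet B' ⊆ ballSet B ∧ β ^ m * B.2 ≤ B'.2 ∧ 0 < B'.2) m B := by
  induction m generalizing B with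
  | zero => exact ⟨h, subset_rfl, by simp, hB⟩
  | succ m ih =>
    obtain ⟨A, hA, h⟩ := h
    refine ⟨A, hA, fun B' hB' => (ih (h B' hB') hB'.1).mono ?_⟩
    rintro B'' ⟨h1, h2, h3, h4⟩
    refine ⟨h1, h2.trans hB'.subset, le_trans ?_ h3, h4⟩
    rw [pow_succ, mul_assoc]
    exact mul_le_mul_of_nonneg_left hB'.2.2 (by positivity)

theorem radius_le_of_ballSet_subset (i : Fin k) {B B' : (Fin k → ℝ) × ℝ} (hB' : 0 < B'.2)
    (h : ballSet B' ⊆ ballSet B) : B'.2 ≤ B.2 := by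
  have h1 : B'.1 + Pi.single i B'.2 ∈ ballSet B := h (by
    simp [ballSet, Pi.norm_single, abs_of_pos hB'])
  have h2 : B'.1 - Pi.single i B'.2 ∈ ballSet B := h (by
    simp [ballSet, Pi.norm_single, abs_of_pos hB'])
  have h3 := (norm_le_pi_norm _ i).trans (mem_closedBall_iff_norm.1 h1)
  have h4 := (norm_le_pi_norm _ i).trans (mem_closedBall_iff_norm.1 h2)
  simp only [Pi.sub_apply, Pi.add_apply, Pi.single_eq_same, Real.norm_eq_abs] at h3 h4
  have := (abs_le.1 h3).2
  have := (abs_le.1 h4).1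
  linarith

/-- In coordinate `i` the smaller ball projects to an interval missing the midpoint of the larger
one, hence contained in one half of it. -/
theorem radius_le_half_of_avoids_center (i : Fin k) {B B' : (Fin k → ℝ) × ℝ} (hB' : 0 < B'.2)
    (h : ballSet B' ⊆ ballSet B) (h' : ∀ u ∈ ballSet B', u i ≠ B.1 i) : B'.2 ≤ B.2 / 2 := by
  have h1 : B'.1 + Pi.single i B'.2 ∈ ballSet B := h (by
    simp [ballSet, Pi.norm_single, abs_of_pos hB'])
  have h2 : B'.1 - Pi.single i B'.2 ∈ ballSet B := h (by
    simp [ballSet, Pi.norm_single, abs_of_pos hB'])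
  have h3 := (norm_le_pi_norm _ i).trans (mem_closedBall_iff_norm.1 h1)
  have h4 := (norm_le_pi_norm _ i).trans (mem_closedBall_iff_norm.1 h2)
  simp only [Pi.sub_apply, Pi.add_apply, Pi.single_eq_same, Real.norm_eq_abs] at h3 h4
  have h5 := (abs_le.1 h3).2
  have h6 := (abs_le.1 h4).1
  have h7 : B'.2 < |B.1 i - B'.1 i| := by
    by_contra! hc
    refine h' (B'.1 + Pi.single i (B.1 i - B'.1 i)) ?_ (by simp)
    simpa [ballSet, Pi.norm_single] using hc
  rcases lt_abs.1 h7 with h8 | h8 <;> linarith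

/-- The rules do not oblige Bob to shrink his balls. Deleting a coordinate hyperplane through the
center makes him halve the radius. -/
theorem force_shrink (i : Fin k) (w : ℕ) (hB : 0 < B.2) :
    Force β (fun B' => B'.2 ≤ B.2 / 2 ^ w) w B := by
  induction w generalizing B with
  | zero => simp [Force]
  | succ w ih =>
    refine ⟨_, isAffineHyperplane_coord i (B.1 i), fun B' hB' => (ih hB'.1).mono fun B'' h => ?_⟩
    have h1 : B'.2 ≤ B.2 / 2 := by
      refine radius_le_half_of_avoids_center i hB'.1 hB'.subset fun u hu hui => (hB'.2.1 hu).2 ?_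
      exact Metric.self_subset_cthickening _ hui
    calc B''.2 ≤ B'.2 / 2 ^ w := h
      _ ≤ B.2 / 2 / 2 ^ w := by gcongr
      _ = B.2 / 2 ^ (w + 1) := by rw [pow_succ]; field_simp

/-- Arbitrary moves fill the spare rounds, so goals reached after different numbers of rounds fit
into blocks of one length. -/
theorem Force.pad {m n : ℕ} (i : Fin k) (hP : ∀ B B', ballSet B' ⊆ ballSet B → P B → P B')
    (h : Force β P m B) (hmn : m ≤ n) : Force β P n B := by
  obtain ⟨a, rfl⟩ := Nat.exists_eq_add_of_le hmn
  refine Force.bind (h.mono fun B' hB' => ?_)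
  clear h
  induction a generalizing B' with
  | zero => exact hB'
  | succ a ih =>
    exact ⟨_, isAffineHyperplane_coord i 0, fun B'' h'' =>
      ih (Nat.le_add_right _ _) _ (hP _ _ h''.subset hB')⟩

end Force

open Classical in
/-- The strategy of Alice that is obtained by playing blocks of `m` rounds, in each of which
she forces `P B₀ B₁` for the first ball `B₀` of the block and the first ball `B₁` of the next. -/
noncomputable def blockStrategy {k : ℕ} (β : ℝ) (i : Fin k) (m : ℕ)
    (P : (Fin k → ℝ) × ℝ → (Fin k → ℝ) × ℝ → Prop) : Strategy k := fun n hist =>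
  let S := hist ⟨m * (n / m), Nat.lt_succ_of_le (Nat.mul_div_le n m)⟩
  -- The number of rounds left in the block is written as a successor so that `Force` unfolds to the
  -- existence of a hyperplane.
  if h : Force β (P S) (m - n % m - 1 + 1) (hist (Fin.last n)) then ⟨h.choose, h.choose_spec.1⟩
  else ⟨_, isAffineHyperplane_coord i 0⟩

/-- The invariant is that after `r` rounds of a block the goal can still be forced in `m - r`
rounds. -/
theorem exists_strategy_of_force {k : ℕ} {β : ℝ} (i : Fin k) {m : ℕ} (hm : 0 < m)
    {P : (Fin k → ℝ) × ℝ → (Fin k → ℝ) × ℝ → Prop}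
    (h : ∀ B : (Fin k → ℝ) × ℝ, 0 < B.2 → Force β (P B) m B) :
    ∃ σ : Strategy k, ∀ B, IsPlay β σ B → ∀ q, P (B (m * q)) (B (m * (q + 1))) := by
  refine ⟨blockStrategy β i m P, fun B hB q => ?_⟩
  have key : ∀ r, r ≤ m → Force β (P (B (m * q))) (m - r) (B (m * q + r)) := by
    intro r
    induction r with
    | zero => intro _; exact h _ (hB.1 _)
    | succ r ih =>
      intro hr
      have h1 := ih (by omega)
      have e1 : (m * q + r) / m = q := by
        rw [Nat.mul_add_div hm, Nat.div_eq_of_lt (by omega), add_zero]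
      have e2 : (m * q + r) % m = r := by
        rw [Nat.mul_add_mod, Nat.mod_eq_of_lt (by omega)]
      have h2 : Force β (P (B (m * ((m * q + r) / m)))) (m - (m * q + r) % m - 1 + 1)
          (B (m * q + r)) := by
        rw [e1, e2, show m - r - 1 + 1 = m - r by omega]
        exact h1
      have h3 := hB.2 (m * q + r)
      have h4 : (blockStrategy β i m P (m * q + r) (fun i => B i)).1 = h2.choose := by
        simp only [blockStrategy]
        rw [dif_pos]
      rw [h4] at h3
      have h5 := h2.choose_spec.2 (B (m * q + r + 1)) ⟨hB.1 _, h3.1, h3.2⟩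
      rw [e1, e2, show m - r - 1 = m - (r + 1) by omega] at h5
      exact h5
  have := key m le_rfl
  rw [Nat.sub_self] at this
  exact this

/-! ### Iterated partial derivatives -/

/-- The iterated partial derivative of `f` in the coordinate directions listed in `s`. -/
noncomputable def pd {k : ℕ} : List (Fin k) → ((Fin k → ℝ) → ℝ) → (Fin k → ℝ) → ℝ
  | [], f => f
  | i :: s, f => fun u => fderiv ℝ (pd s f) u (Pi.single i 1)

section Partials

variable {k d : ℕ} {U W : Set (Fin k → ℝ)} {f : (Fin k → ℝ) → ℝ}

theorem contDiffOn_pd (hU : IsOpen U) (hf : ContDiffOn ℝ ∞ f U) (s : List (Fin k)) :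
    ContDiffOn ℝ ∞ (pd s f) U := by
  induction s with
  | nil => exact hf
  | cons i s ih =>
    exact (ih.fderiv_of_isOpen hU (m := ∞) (by simp)).clm_apply contDiffOn_const

theorem differentiableAt_pd (hU : IsOpen U) (hf : ContDiffOn ℝ ∞ f U) (s : List (Fin k))
    {u : Fin k → ℝ} (hu : u ∈ U) : DifferentiableAt ℝ (pd s f) u :=
  ((contDiffOn_pd hU hf s).contDiffAt (hU.mem_nhds hu)).differentiableAt (by simp)

theorem pd_affine (hU : IsOpen U) {F : Fin d → (Fin k → ℝ) → ℝ}
    (hF : ∀ l, ContDiffOn ℝ ∞ (F l) U) (a : Fin d → ℝ) (b : ℝ) (s : List (Fin k))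
    {u : Fin k → ℝ} (hu : u ∈ U) :
    pd s (fun v => b + ∑ l, a l * F l v) u =
      (if s = [] then b else 0) + ∑ l, a l * pd s (F l) u := by
  induction s generalizing u with
  | nil => simp [pd]
  | cons i s ih =>
    have h1 : pd s (fun v => b + ∑ l, a l * F l v) =ᶠ[nhds u]
        fun v => (if s = [] then b else 0) + ∑ l, a l * pd s (F l) v := by
      filter_upwards [hU.mem_nhds hu] with v hv using ih hv
    have h2 : HasFDerivAt (fun v => (if s = [] then b else 0) + ∑ l, a l * pd s (F l) v)
        (∑ l, a l • fderiv ℝ (pd s (F l)) u) u := by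
      refine HasFDerivAt.const_add _ (HasFDerivAt.fun_sum fun l _ => ?_)
      exact (differentiableAt_pd hU (hF l) s hu).hasFDerivAt.const_mul (a l)
    simp only [pd, h1.fderiv_eq, h2.fderiv]
    simp

theorem pd_ofFn_eq_iteratedFDeriv (hU : IsOpen U) {Φ : (Fin k → ℝ) → (Fin d → ℝ)}
    (hΦ : ContDiffOn ℝ ∞ Φ U) (l : Fin d) {n : ℕ} (s : Fin n → Fin k)
    {u : Fin k → ℝ} (hu : u ∈ U) :
    pd (List.ofFn s) (fun v => Φ v l) u =
      iteratedFDeriv ℝ n Φ u (fun j => Pi.single (s j) (1 : ℝ)) l := by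
  induction n generalizing u with
  | zero => simp [pd]
  | succ n ih =>
    rw [List.ofFn_succ]
    have h1 : pd (List.ofFn fun j => s j.succ) (fun v => Φ v l) =ᶠ[nhds u]
        fun v => iteratedFDeriv ℝ n Φ v (fun j => Pi.single (s j.succ) (1 : ℝ)) l := by
      filter_upwards [hU.mem_nhds hu] with v hv using ih _ hv
    have h3 : DifferentiableAt ℝ (iteratedFDeriv ℝ n Φ) u :=
      (hΦ.contDiffAt (hU.mem_nhds hu)).differentiableAt_iteratedFDeriv
        (by exact_mod_cast WithTop.coe_lt_top _)
    have h4 := (h3.hasFDerivAt.continuousMultilinear_apply_const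
      (fun j => Pi.single (s j.succ) (1 : ℝ)))
    have h5 := (hasFDerivAt_pi'.1 h4 l)
    simp only [pd, h1.fderiv_eq]
    rw [h5.fderiv, iteratedFDeriv_succ_apply_left]
    rfl

theorem clm_apply_eq_sum (L : (Fin k → ℝ) →L[ℝ] ℝ) (h : Fin k → ℝ) :
    L h = ∑ i, h i * L (Pi.single i 1) := by
  conv_lhs => rw [← Finset.univ_sum_single h]
  rw [map_sum]
  refine Finset.sum_congr rfl fun i _ => ?_
  rw [← smul_eq_mul, ← map_smul, ← Pi.single_smul, smul_eq_mul, mul_one]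

theorem fderiv_apply_eq_sum (u h : Fin k → ℝ) :
    fderiv ℝ f u h = ∑ i, h i * pd [i] f u :=
  clm_apply_eq_sum _ h

theorem norm_le_of_abs_apply_single_le (L : (Fin k → ℝ) →L[ℝ] ℝ) {C : ℝ} (hC : 0 ≤ C)
    (h : ∀ i, |L (Pi.single i 1)| ≤ C) : ‖L‖ ≤ k * C := by
  refine L.opNorm_le_bound (by positivity) fun v => ?_
  rw [clm_apply_eq_sum L v]
  calc ‖∑ i, v i * L (Pi.single i 1)‖
      ≤ ∑ i : Fin k, ‖v‖ * C := norm_sum_le_of_le _ fun i _ => by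
        rw [norm_mul]
        exact mul_le_mul (norm_le_pi_norm v i) (h i) (norm_nonneg _) (norm_nonneg _)
    _ = k * C * ‖v‖ := by simp; ring

theorem abs_sub_le_of_abs_pd_le (hW : Convex ℝ W) (hf : ∀ u ∈ W, DifferentiableAt ℝ f u)
    {C : ℝ} (hC : 0 ≤ C) (h : ∀ u ∈ W, ∀ i, |pd [i] f u| ≤ C) {x u : Fin k → ℝ} (hx : x ∈ W)
    (hu : u ∈ W) : |f u - f x| ≤ k * C * ‖u - x‖ :=
  hW.norm_image_sub_le_of_norm_fderiv_le hf
    (fun v hv => norm_le_of_abs_apply_single_le _ hC (h v hv)) hx hu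

theorem abs_sub_linear_le_of_abs_pd_le (hW : Convex ℝ W)
    (hf : ∀ u ∈ W, DifferentiableAt ℝ f u) (hf' : ∀ i, ∀ u ∈ W, DifferentiableAt ℝ (pd [i] f) u)
    {C : ℝ} (hC : 0 ≤ C) (h : ∀ u ∈ W, ∀ i j, |pd [i, j] f u| ≤ C) {x u : Fin k → ℝ}
    (hx : x ∈ W) (hu : u ∈ W) :
    |f u - f x - ∑ i, (u i - x i) * pd [i] f x| ≤ k * (k * C) * ‖u - x‖ ^ 2 := by
  -- Restricting to this ball bounds the variation of the gradient by a multiple of `‖u - x‖`; the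
  -- mean value inequality supplies the second such factor.
  have h1 : ∀ v ∈ W ∩ Metric.closedBall x ‖u - x‖,
      ‖fderiv ℝ f v - fderiv ℝ f x‖ ≤ k * (k * C * ‖u - x‖) := fun v hv => by
    refine norm_le_of_abs_apply_single_le _ (by positivity) fun i => ?_
    refine (abs_sub_le_of_abs_pd_le hW (hf' i) hC (fun w hw j => h w hw j i) hx hv.1).trans ?_
    gcongr
    exact mem_closedBall_iff_norm.1 hv.2
  have h2 := (hW.inter (convex_closedBall x ‖u - x‖)).norm_image_sub_le_of_norm_hasFDerivWithin_le'
    (fun v hv => (hf v hv.1).hasFDerivAt.hasFDerivWithinAt) h1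
    ⟨hx, Metric.mem_closedBall_self (norm_nonneg _)⟩ ⟨hu, mem_closedBall_iff_norm.2 le_rfl⟩
  rw [fderiv_apply_eq_sum] at h2
  refine h2.trans (le_of_eq ?_)
  ring

/-! ### Taylor's formula -/

/-- The derivative of the remainder is the remainder of one order less for `φ 1`, so induction and
the mean value inequality suffice. Factorials in the bound are dropped, as `t ≤ 1`. -/
theorem abs_sub_taylor_le {n : ℕ} {φ : ℕ → ℝ → ℝ} {C : ℝ}
    (hφ : ∀ j ≤ n, ∀ t ∈ Set.Icc (0 : ℝ) 1, HasDerivAt (φ j) (φ (j + 1) t) t)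
    (hC : ∀ t ∈ Set.Icc (0 : ℝ) 1, |φ (n + 1) t| ≤ C) {t : ℝ} (ht : t ∈ Set.Icc (0 : ℝ) 1) :
    |φ 0 t - ∑ j ∈ Finset.range (n + 1), φ j 0 * (t ^ j / j.factorial)| ≤ C := by
  induction n generalizing φ t with
  | zero =>
    have h0 : 0 ≤ C := (abs_nonneg _).trans (hC t ht)
    have := norm_image_sub_le_of_norm_deriv_le_segment'
      (fun s hs => (hφ 0 le_rfl s hs).hasDerivWithinAt)
      (fun s hs => hC s (Set.Ico_subset_Icc_self hs)) t ht
    simp only [Real.norm_eq_abs] at this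
    simp only [zero_add, Finset.range_one, Finset.sum_singleton, pow_zero, Nat.factorial_zero,
      Nat.cast_one, div_one, mul_one]
    nlinarith [ht.2]
  | succ n ih =>
    have h0 : 0 ≤ C := (abs_nonneg _).trans (hC t ht)
    have h1 : ∀ s ∈ Set.Icc (0 : ℝ) 1, HasDerivAt
        (fun s => φ 0 s - ∑ j ∈ Finset.range (n + 1 + 1), φ j 0 * (s ^ j / j.factorial))
        (φ 1 s - ∑ j ∈ Finset.range (n + 1), φ (j + 1) 0 * (s ^ j / j.factorial)) s := by
      intro s hs
      refine (hφ 0 (Nat.zero_le _) s hs).sub ?_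
      simp only [Finset.sum_range_succ' _ (n + 1)]
      simp only [pow_zero]
      refine HasDerivAt.add_const _ (HasDerivAt.fun_sum fun j _ => ?_)
      have h2 := ((hasDerivAt_pow (j + 1) s).div_const ((j + 1).factorial : ℝ)).const_mul
        (φ (j + 1) 0)
      refine h2.congr_deriv ?_
      have : (j.factorial : ℝ) ≠ 0 := by positivity
      simp only [Nat.add_sub_cancel, Nat.factorial_succ]
      push_cast
      field_simp
    have h2 := norm_image_sub_le_of_norm_deriv_le_segment'
      (fun s hs => (h1 s hs).hasDerivWithinAt)
      (fun s hs => ih (φ := fun j => φ (j + 1)) (fun j hj s hs => hφ (j + 1) (by omega) s hs)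
        hC (Set.Ico_subset_Icc_self hs)) t ht
    simp only [Real.norm_eq_abs] at h2
    have h3 : φ 0 0 - ∑ j ∈ Finset.range (n + 1 + 1), φ j 0 * ((0 : ℝ) ^ j / j.factorial) = 0 := by
      rw [Finset.sum_range_succ']
      simp
    rw [h3, sub_zero] at h2
    nlinarith [ht.2]

/-- The sum over words of length `j` is the `j`-th derivative of `f` along the line; differentiating
once more prepends a letter to each word. -/
theorem hasDerivAt_directional (hU : IsOpen U) (hf : ContDiffOn ℝ ∞ f U) (x h : Fin k → ℝ)
    (j : ℕ) {t : ℝ} (ht : x + t • h ∈ U) :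
    HasDerivAt (fun t : ℝ => ∑ s : Fin j → Fin k, (∏ l, h (s l)) * pd (List.ofFn s) f (x + t • h))
      (∑ s : Fin (j + 1) → Fin k, (∏ l, h (s l)) * pd (List.ofFn s) f (x + t • h)) t := by
  have h1 : (∑ s : Fin (j + 1) → Fin k, (∏ l, h (s l)) * pd (List.ofFn s) f (x + t • h)) =
      ∑ s : Fin j → Fin k, (∏ l, h (s l)) *
        fderiv ℝ (pd (List.ofFn s) f) (x + t • h) h := by
    rw [← (Fin.consEquiv fun _ => Fin k).sum_comp, Fintype.sum_prod_type, Finset.sum_comm]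
    refine Finset.sum_congr rfl fun s _ => ?_
    rw [fderiv_apply_eq_sum, Finset.mul_sum]
    refine Finset.sum_congr rfl fun i _ => ?_
    simp only [Fin.consEquiv_apply, Fin.prod_univ_succ, Fin.cons_zero, Fin.cons_succ,
      List.ofFn_succ, pd]
    ring
  rw [h1]
  refine HasDerivAt.fun_sum fun s _ => HasDerivAt.const_mul _ ?_
  have h2 : HasDerivAt (fun t : ℝ => x + t • h) h t := by
    simpa using ((hasDerivAt_id t).smul_const h).const_add x
  exact (differentiableAt_pd hU hf _ ht).hasFDerivAt.comp_hasDerivAt t h2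

theorem abs_sub_taylor_pd_le (hU : IsOpen U) (hf : ContDiffOn ℝ ∞ f U) (hW : Convex ℝ W)
    (hWU : W ⊆ U) {n : ℕ} {C : ℝ}
    (hC : ∀ u ∈ W, ∀ s : Fin (n + 1) → Fin k, |pd (List.ofFn s) f u| ≤ C) {x u : Fin k → ℝ}
    (hx : x ∈ W) (hu : u ∈ W) :
    |f u - ∑ j ∈ Finset.range (n + 1), ∑ s : Fin j → Fin k,
      (∏ l, (u - x) (s l)) * (pd (List.ofFn s) f x / j.factorial)| ≤
      k ^ (n + 1) * C * ‖u - x‖ ^ (n + 1) := by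
  have hseg : ∀ t ∈ Set.Icc (0 : ℝ) 1, x + t • (u - x) ∈ W := fun t ht =>
    hW.add_smul_sub_mem hx hu ht
  have key := abs_sub_taylor_le (n := n)
    (φ := fun j t => ∑ s : Fin j → Fin k,
      (∏ l, (u - x) (s l)) * pd (List.ofFn s) f (x + t • (u - x)))
    (C := k ^ (n + 1) * C * ‖u - x‖ ^ (n + 1))
    (fun j _ t ht => hasDerivAt_directional hU hf x (u - x) j (hWU (hseg t ht)))
    (fun t ht => ?_) (t := 1) (by simp)
  · convert key using 3
    · simp [pd]
    · refine Finset.sum_congr rfl fun j _ => ?_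
      rw [Finset.sum_mul]
      refine Finset.sum_congr rfl fun s _ => ?_
      simp only [zero_smul, add_zero, one_pow]
      ring
  · calc |∑ s : Fin (n + 1) → Fin k, (∏ l, (u - x) (s l)) *
          pd (List.ofFn s) f (x + t • (u - x))|
        ≤ ∑ s : Fin (n + 1) → Fin k, ‖u - x‖ ^ (n + 1) * C := by
          refine (Finset.abs_sum_le_sum_abs _ _).trans (Finset.sum_le_sum fun s _ => ?_)
          rw [abs_mul, Finset.abs_prod]
          refine mul_le_mul ?_ (hC _ (hseg t ht) s) (abs_nonneg _) (by positivity)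
          calc ∏ l, |(u - x) (s l)| ≤ ∏ _l : Fin (n + 1), ‖u - x‖ :=
                Finset.prod_le_prod (fun _ _ => abs_nonneg _) fun l _ =>
                  norm_le_pi_norm (u - x) (s l)
            _ = _ := by simp
      _ = k ^ (n + 1) * C * ‖u - x‖ ^ (n + 1) := by simp; ring

end Partials

/-! ### Determinants of values of smooth functions at nearby points -/

/-- The monomials of degree at most `n` in `k` variables. -/
abbrev Mon (k n : ℕ) : Type := Σ j : Fin (n + 1), Sym (Fin k) j

/-- The value of a monomial. -/
def Mon.eval {k n : ℕ} (o : Mon k n) (h : Fin k → ℝ) : ℝ := ((o.2 : Multiset (Fin k)).map h).prod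

section Determinant

variable {k n : ℕ}

theorem Mon.abs_eval_le (o : Mon k n) {h : Fin k → ℝ} {ρ : ℝ} (hh : ‖h‖ ≤ ρ) :
    |o.eval h| ≤ ρ ^ (o.1 : ℕ) := by
  have hρ : 0 ≤ ρ := (norm_nonneg h).trans hh
  have key : ∀ m : Multiset (Fin k), |(m.map h).prod| ≤ ρ ^ (Multiset.card m) := by
    intro m
    induction m using Multiset.induction with
    | empty => simp
    | cons a m ih =>
      rw [Multiset.map_cons, Multiset.prod_cons, Multiset.card_cons, pow_succ', abs_mul]
      exact mul_le_mul ((norm_le_pi_norm h a).trans hh) ih (abs_nonneg _) hρ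
  simpa [Mon.eval] using key o.2

/-- Words are grouped by their multiset of letters. The exponent depends on this: degree `j` must
contribute `[k-1,j]` terms, not `k ^ j`. -/
theorem exists_taylor_expansion {U W : Set (Fin k → ℝ)} {f : (Fin k → ℝ) → ℝ} (hU : IsOpen U)
    (hf : ContDiffOn ℝ ∞ f U) (hW : Convex ℝ W) (hWU : W ⊆ U) {C : ℝ}
    (hC : ∀ u ∈ W, ∀ s : List (Fin k), s.length ≤ n + 1 → |pd s f u| ≤ C) {x : Fin k → ℝ}
    (hx : x ∈ W) :
    ∃ c : Mon k n → ℝ, (∀ o, |c o| ≤ (k + 1) ^ (n + 1) * C) ∧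
      ∀ u ∈ W, |f u - ∑ o, c o * o.eval (u - x)| ≤ (k + 1) ^ (n + 1) * C * ‖u - x‖ ^ (n + 1) := by
  classical
  have hC0 : 0 ≤ C := (abs_nonneg _).trans (hC x hx [] (by simp))
  let toSym (j : ℕ) (s : Fin j → Fin k) : Sym (Fin k) j :=
    ⟨Finset.univ.val.map s, by simp⟩
  refine ⟨fun o => ∑ s with toSym o.1 s = o.2, pd (List.ofFn s) f x / (o.1 : ℕ).factorial,
    fun o => ?_, fun u hu => ?_⟩
  · calc |∑ s with toSym o.1 s = o.2, pd (List.ofFn s) f x / (o.1 : ℕ).factorial|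
        ≤ ∑ s with toSym o.1 s = o.2, |pd (List.ofFn s) f x / (o.1 : ℕ).factorial| :=
          Finset.abs_sum_le_sum_abs _ _
      _ ≤ ∑ s : Fin o.1 → Fin k, |pd (List.ofFn s) f x / (o.1 : ℕ).factorial| :=
          Finset.sum_le_sum_of_subset_of_nonneg (Finset.filter_subset _ _)
            fun _ _ _ => abs_nonneg _
      _ ≤ ∑ s : Fin o.1 → Fin k, C := Finset.sum_le_sum fun s _ => by
          rw [abs_div, Nat.abs_cast]
          have h1 : (1 : ℝ) ≤ (o.1 : ℕ).factorial := by
            exact_mod_cast Nat.one_le_iff_ne_zero.2 (Nat.factorial_ne_zero _)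
          refine (div_le_self (abs_nonneg _) h1).trans (hC x hx _ ?_)
          simp only [List.length_ofFn]
          omega
      _ = (k : ℝ) ^ (o.1 : ℕ) * C := by simp
      _ ≤ (k + 1) ^ (n + 1) * C := by
          refine mul_le_mul_of_nonneg_right ?_ hC0
          calc (k : ℝ) ^ (o.1 : ℕ) ≤ (k + 1) ^ (o.1 : ℕ) := by gcongr; linarith
            _ ≤ (k + 1) ^ (n + 1) := pow_le_pow_right₀ (by linarith [Nat.cast_nonneg (α := ℝ) k])
                (by omega)
  · have h1 := abs_sub_taylor_pd_le hU hf hW hWU (n := n) (C := C)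
      (fun v hv s => hC v hv _ (by simp)) hx hu
    have h2 : ∑ o : Mon k n, (∑ s with toSym o.1 s = o.2,
          pd (List.ofFn s) f x / (o.1 : ℕ).factorial) * o.eval (u - x) =
        ∑ j ∈ Finset.range (n + 1), ∑ s : Fin j → Fin k,
          (∏ l, (u - x) (s l)) * (pd (List.ofFn s) f x / j.factorial) := by
      rw [Fintype.sum_sigma, Finset.sum_range]
      refine Finset.sum_congr rfl fun j _ => ?_
      rw [← Finset.sum_fiberwise Finset.univ (toSym j)]
      refine Finset.sum_congr rfl fun α _ => ?_
      rw [Finset.sum_mul]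
      refine Finset.sum_congr rfl fun s hs => ?_
      rw [← (Finset.mem_filter.1 hs).2, mul_comm]
      simp [Mon.eval, toSym, Finset.prod, Function.comp_def]
    rw [h2]
    refine h1.trans ?_
    gcongr
    linarith

/-- The order of vanishing that a row of a Taylor expansion contributes: the degree of a monomial,
or `n + 1` for the remainder term. -/
def rowDeg : Option (Mon k n) → ℕ
  | none => n + 1
  | some o => o.1

/-- Count deficits `n + 1 - rowDeg`: remainders have none, and each monomial occurs at most once, so
the total deficit is at most that of all monomials together. -/
theorem le_sum_rowDeg (hk : 1 ≤ k) {p N : ℕ}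
    (hN : N + ∑ j ∈ Finset.range (n + 1), (n + 1 - j) * brk (k - 1) j = (n + 1) * p)
    {r : Fin p → Option (Mon k n)} (hr : ∀ i i' o, r i = some o → r i' = some o → i = i') :
    N ≤ ∑ i, rowDeg (r i) := by
  classical
  have h1 : ∑ i, (n + 1 - rowDeg (r i)) ≤ ∑ o : Option (Mon k n), (n + 1 - rowDeg o) := by
    rw [← Finset.sum_fiberwise Finset.univ r]
    refine Finset.sum_le_sum fun o _ => ?_
    rw [Finset.sum_congr rfl (g := fun _ => n + 1 - rowDeg o)
      fun i hi => by rw [(Finset.mem_filter.1 hi).2], Finset.sum_const, smul_eq_mul]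
    cases o with
    | none => simp [rowDeg]
    | some o =>
      refine (Nat.mul_le_mul_right _ (Finset.card_le_one.2 fun i hi i' hi' => ?_)).trans
        (one_mul _).le
      exact hr i i' o (Finset.mem_filter.1 hi).2 (Finset.mem_filter.1 hi').2
  have h2 : ∑ o : Option (Mon k n), (n + 1 - rowDeg o) =
      ∑ j ∈ Finset.range (n + 1), (n + 1 - j) * brk (k - 1) j := by
    rw [Fintype.sum_option, Fintype.sum_sigma, Finset.sum_range]
    simp only [rowDeg, Nat.sub_self, zero_add, Finset.sum_const, smul_eq_mul, Finset.card_univ]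
    refine Finset.sum_congr rfl fun j _ => ?_
    rw [Sym.card_sym_eq_choose, Fintype.card_fin, mul_comm, brk]
    congr 2
    omega
  have h3 : ∑ i, (n + 1 - rowDeg (r i)) + ∑ i, rowDeg (r i) = (n + 1) * p := by
    rw [← Finset.sum_add_distrib, Finset.sum_congr rfl (g := fun _ => n + 1)]
    · simp [mul_comm]
    · intro i _
      refine Nat.sub_add_cancel ?_
      cases r i with
      | none => simp [rowDeg]
      | some o => simp only [rowDeg]; omega
  omega

theorem abs_det_taylor_le (hk : 1 ≤ k) {p N : ℕ}
    (hN : N + ∑ j ∈ Finset.range (n + 1), (n + 1 - j) * brk (k - 1) j = (n + 1) * p)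
    {C ρ : ℝ} (hρ : 0 < ρ) (hρ1 : ρ ≤ 1) {c : Fin p → Mon k n → ℝ} (hc : ∀ l o, |c l o| ≤ C)
    {h : Fin p → Fin k → ℝ} (hh : ∀ i, ‖h i‖ ≤ ρ) {A : Matrix (Fin p) (Fin p) ℝ}
    (hA : ∀ i l, |A i l - ∑ o, c l o * o.eval (h i)| ≤ C * ρ ^ (n + 1)) :
    |A.det| ≤ (Fintype.card (Mon k n) + 1) ^ p * (p.factorial * C ^ p) * ρ ^ N := by
  classical
  have hρn : (0 : ℝ) < ρ ^ (n + 1) := by positivity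
  -- Weights `w` carry the powers of `ρ`, vectors `v` have entries at most `C`. The vector of a
  -- monomial does not depend on the row, so a repeated monomial gives two equal rows.
  let w (i : Fin p) : Option (Mon k n) → ℝ
    | none => ρ ^ (n + 1)
    | some o => o.eval (h i)
  let v (i : Fin p) : Option (Mon k n) → Fin p → ℝ
    | none => fun l => (A i l - ∑ o, c l o * o.eval (h i)) / ρ ^ (n + 1)
    | some o => fun l => c l o
  have h1 : A = fun i => ∑ o, w i o • v i o := by
    ext i l
    rw [Finset.sum_apply, Fintype.sum_option]
    simp only [w, v, Pi.smul_apply, smul_eq_mul]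
    rw [mul_div_cancel₀ _ hρn.ne']
    simp [mul_comm]
  have h2 : A.det = ∑ r : Fin p → Option (Mon k n),
      (∏ i, w i (r i)) * Matrix.det (Matrix.of fun i => v i (r i)) := by
    conv_lhs => rw [h1]
    refine ((Matrix.detRowAlternating (R := ℝ) (n := Fin p)).toMultilinearMap.map_sum _).trans ?_
    refine Finset.sum_congr rfl fun r _ => ?_
    exact (Matrix.detRowAlternating (R := ℝ) (n := Fin p)).toMultilinearMap.map_smul_univ _ _
  have h3 : ∀ r : Fin p → Option (Mon k n),
      |(∏ i, w i (r i)) * Matrix.det (Matrix.of fun i => v i (r i))| ≤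
        p.factorial * C ^ p * ρ ^ N := by
    intro r
    by_cases hr : ∀ i i' o, r i = some o → r i' = some o → i = i'
    · have h4 : |∏ i, w i (r i)| ≤ ρ ^ N := by
        rw [Finset.abs_prod]
        calc ∏ i, |w i (r i)| ≤ ∏ i, ρ ^ rowDeg (r i) :=
              Finset.prod_le_prod (fun _ _ => abs_nonneg _) fun i _ => by
                cases r i with
                | none => simp [w, rowDeg, abs_of_pos hρ]
                | some o => exact o.abs_eval_le (hh i)
          _ = ρ ^ ∑ i, rowDeg (r i) := Finset.prod_pow_eq_pow_sum _ _ _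
          _ ≤ ρ ^ N := pow_le_pow_of_le_one hρ.le hρ1 (le_sum_rowDeg hk hN hr)
      have h5 : |Matrix.det (Matrix.of fun i => v i (r i))| ≤ p.factorial * C ^ p := by
        have := Matrix.det_le (A := Matrix.of fun i => v i (r i)) (abv := AbsoluteValue.abs)
          (x := C) fun i l => by
            simp only [Matrix.of_apply, AbsoluteValue.abs_apply]
            cases r i with
            | none =>
              simp only [v]
              rw [abs_div, abs_of_pos hρn, div_le_iff₀ hρn]
              exact hA i l
            | some o => exact hc l o
        simpa using this
      rw [abs_mul, mul_comm]
      exact mul_le_mul h5 h4 (abs_nonneg _) ((abs_nonneg _).trans h5)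
    · push Not at hr
      obtain ⟨i, i', o, hi, hi', hne⟩ := hr
      rw [Matrix.det_zero_of_row_eq hne (by ext l; simp [hi, hi', v]), mul_zero, abs_zero]
      have hC : 0 ≤ C := (abs_nonneg _).trans (hc i o)
      positivity
  rw [h2]
  calc _ ≤ ∑ r : Fin p → Option (Mon k n), p.factorial * C ^ p * ρ ^ N :=
        (Finset.abs_sum_le_sum_abs _ _).trans (Finset.sum_le_sum fun r _ => h3 r)
    _ = _ := by
        simp only [Finset.sum_const, Finset.card_univ, Fintype.card_fun, Fintype.card_option,
          Fintype.card_fin, nsmul_eq_mul]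
        push_cast
        ring

end Determinant

/-! ### Arithmetic of the exponent. -/

theorem sum_Icc_brk_add_mkd (k d : ℕ) :
    ∑ j ∈ Finset.Icc 1 (nkd k d), brk (k - 1) j + mkd k d = d :=
  Nat.add_sub_cancel' (isGreatest_nkd k d).1

/-- Matches `Nkd` with the deficit count. The extra row in `d + 1` is for the constant monomial,
which has degree `0` and adds nothing to `Nkd`. -/
theorem Nkd_add_sum (k d : ℕ) :
    Nkd k d + ∑ j ∈ Finset.range (nkd k d + 1), (nkd k d + 1 - j) * brk (k - 1) j =
      (nkd k d + 1) * (d + 1) := by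
  have h1 := sum_Icc_brk_add_mkd k d
  have h2 : ∀ g : ℕ → ℕ, ∑ j ∈ Finset.range (nkd k d + 1), g j =
      g 0 + ∑ j ∈ Finset.Icc 1 (nkd k d), g j := fun g => by
    rw [Finset.range_eq_Ico, Finset.sum_eq_sum_Ico_succ_bot (by omega)]
    rfl
  have h3 : ∑ j ∈ Finset.Icc 1 (nkd k d), (nkd k d + 1 - j) * brk (k - 1) j +
      ∑ j ∈ Finset.Icc 1 (nkd k d), j * brk (k - 1) j =
      (nkd k d + 1) * ∑ j ∈ Finset.Icc 1 (nkd k d), brk (k - 1) j := by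
    rw [← Finset.sum_add_distrib, Finset.mul_sum]
    refine Finset.sum_congr rfl fun j hj => ?_
    rw [← add_mul, Nat.sub_add_cancel]
    have := (Finset.mem_Icc.1 hj).2
    omega
  rw [h2, Nkd]
  have h4 : brk (k - 1) 0 = 1 := by simp [brk]
  rw [h4]
  have h5 : (nkd k d + 1) * (d + 1) = (nkd k d + 1) *
    (∑ j ∈ Finset.Icc 1 (nkd k d), brk (k - 1) j + mkd k d + 1) := by rw [h1]
  rw [h5, mul_add, mul_add, ← h3]
  simp only [Nat.sub_zero]
  ring

theorem le_Nkd (k d : ℕ) : d ≤ Nkd k d := by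
  conv_lhs => rw [← sum_Icc_brk_add_mkd k d]
  refine Nat.add_le_add (Finset.sum_le_sum fun j hj => ?_) (Nat.le_mul_of_pos_left _ (by omega))
  exact Nat.le_mul_of_pos_left _ (Finset.mem_Icc.1 hj).1

/-! ### Rational points of small height near a point lie on a hyperplane -/

theorem height_pos {d : ℕ} (r : Fin d → ℚ) : 0 < height r :=
  Nat.pos_of_ne_zero fun h => by
    obtain ⟨i, _, hi⟩ := Finset.lcm_eq_zero_iff.1 h
    exact (r i).den_nz hi

theorem exists_int_eq_height_mul {d : ℕ} (r : Fin d → ℚ) (l : Fin d) :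
    ∃ z : ℤ, (z : ℝ) = height r * ratPoint r l := by
  obtain ⟨c, hc⟩ : (r l).den ∣ height r := Finset.dvd_lcm (Finset.mem_univ l)
  refine ⟨(r l).num * c, ?_⟩
  rw [hc, ratPoint]
  have h1 : ((r l : ℚ) : ℝ) * ((r l).den : ℝ) = ((r l).num : ℝ) := by
    exact_mod_cast Rat.mul_den_eq_num (r l)
  push_cast
  rw [← h1]
  ring

theorem one_le_prod_height_mul_abs_det {d : ℕ} {r : Fin (d + 1) → Fin d → ℚ}
    (h : Matrix.det (Matrix.of fun i => (Fin.cons 1 (ratPoint (r i)) : Fin (d + 1) → ℝ)) ≠ 0) :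
    1 ≤ (∏ i, (height (r i) : ℝ)) *
      |Matrix.det (Matrix.of fun i => (Fin.cons 1 (ratPoint (r i)) : Fin (d + 1) → ℝ))| := by
  have hz : ∀ i l, ∃ z : ℤ,
      (z : ℝ) = height (r i) * (Fin.cons 1 (ratPoint (r i)) : Fin (d + 1) → ℝ) l := by
    intro i l
    refine Fin.cases ⟨height (r i), by simp⟩ (fun l => ?_) l
    obtain ⟨z, hz⟩ := exists_int_eq_height_mul (r i) l
    exact ⟨z, by simpa using hz⟩
  choose z hz using hz
  have h1 : ((Matrix.det (Matrix.of z) : ℤ) : ℝ) = (∏ i, (height (r i) : ℝ)) *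
      Matrix.det (Matrix.of fun i => (Fin.cons 1 (ratPoint (r i)) : Fin (d + 1) → ℝ)) := by
    rw [← Matrix.det_mul_column, show ((Matrix.det (Matrix.of z) : ℤ) : ℝ) =
      Int.castRingHom ℝ (Matrix.det (Matrix.of z)) from rfl, RingHom.map_det]
    congr 1
    ext i l
    simp [hz]
  have h2 : (0 : ℝ) < ∏ i, (height (r i) : ℝ) :=
    Finset.prod_pos fun i _ => by exact_mod_cast height_pos (r i)
  have h3 : Matrix.det (Matrix.of z) ≠ 0 := by
    intro h0
    rw [h0, Int.cast_zero] at h1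
    exact (mul_ne_zero h2.ne' h) h1.symm
  have h4 : (1 : ℝ) ≤ |((Matrix.det (Matrix.of z) : ℤ) : ℝ)| := by
    exact_mod_cast Int.one_le_abs h3
  rwa [h1, abs_mul, abs_of_pos h2] at h4

/-- If the vectors `(1, r)` spanned the space, a basis among them would have a nonzero determinant
too small for its heights. So a nonzero functional kills them all. -/
theorem exists_affine_of_abs_det_le {d : ℕ} (hd : 1 ≤ d) {S : Set (Fin d → ℚ)} {Y : ℝ}
    (hdet : ∀ r : Fin (d + 1) → Fin d → ℚ, (∀ i, r i ∈ S) →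
      |Matrix.det (Matrix.of fun i => (Fin.cons 1 (ratPoint (r i)) : Fin (d + 1) → ℝ))| ≤ Y)
    (hY : ∀ r ∈ S, Y * (height r : ℝ) ^ (d + 1) < 1) :
    ∃ (b : ℝ) (a : Fin d → ℝ), ‖a‖ = 1 ∧ ∀ r ∈ S, b + ∑ l, a l * ratPoint r l = 0 := by
  let T : Set (Fin (d + 1) → ℝ) := (fun r => Fin.cons 1 (ratPoint r)) '' S
  have hT : Submodule.span ℝ T ≠ ⊤ := by
    intro htop
    obtain ⟨f, hf1, -, hf3⟩ := Submodule.exists_fun_fin_finrank_span_eq ℝ T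
    have hfr : d + 1 = Module.finrank ℝ (Submodule.span ℝ T) := by
      rw [htop, finrank_top, Module.finrank_fin_fun]
    choose r hrS hrf using hf1
    have h1 : LinearIndependent ℝ (fun i => f (Fin.cast hfr i)) :=
      hf3.comp _ (Fin.cast_injective hfr)
    let g : Fin (d + 1) → Fin d → ℚ := fun i => r (Fin.cast hfr i)
    have h2 : Matrix.det
        (Matrix.of fun i => (Fin.cons 1 (ratPoint (g i)) : Fin (d + 1) → ℝ)) ≠ 0 := by
      refine ((Matrix.isUnit_iff_isUnit_det _).1 (Matrix.linearIndependent_rows_iff_isUnit.1 ?_)).ne_zero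
      have h2 : (Matrix.of fun i => (Fin.cons 1 (ratPoint (g i)) : Fin (d + 1) → ℝ)).row =
          fun i => f (Fin.cast hfr i) := funext fun i => hrf _
      rw [h2]
      exact h1
    have h3 := one_le_prod_height_mul_abs_det h2
    have h4 := hdet g fun i => hrS _
    obtain ⟨i₀, hi₀⟩ := Finite.exists_max fun i => height (g i)
    have h5 := hY (g i₀) (hrS _)
    have h6 : ∏ i, (height (g i) : ℝ) ≤ (height (g i₀) : ℝ) ^ (d + 1) := by
      refine (Finset.prod_le_prod (fun _ _ => Nat.cast_nonneg _)
        fun i _ => Nat.cast_le.2 (hi₀ i)).trans ?_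
      simp
    have h7 := mul_le_mul h6 h4 (abs_nonneg _) (by positivity)
    linarith
  obtain ⟨φ, hφ, hφT⟩ := Submodule.exists_le_ker_of_lt_top _ (lt_top_iff_ne_top.2 hT)
  have h1 : ∀ v, φ v = φ (Pi.single 0 1) * v 0 + ∑ l : Fin d, φ (Pi.single l.succ 1) * v l.succ := by
    intro v
    conv_lhs => rw [← Finset.univ_sum_single v]
    rw [map_sum, Fin.sum_univ_succ]
    have : ∀ i, φ (Pi.single i (v i)) = φ (Pi.single i 1) * v i := fun i => by
      rw [mul_comm, ← smul_eq_mul, ← map_smul, ← Pi.single_smul, smul_eq_mul, mul_one]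
    simp only [this]
  have h2 : ∀ r ∈ S, φ (Pi.single 0 1) + ∑ l : Fin d, φ (Pi.single l.succ 1) * ratPoint r l = 0 := by
    intro r hr
    have := hφT (Submodule.subset_span (Set.mem_image_of_mem _ hr))
    rw [LinearMap.mem_ker, h1] at this
    simpa using this
  -- If the linear part vanishes, the functional is a nonzero constant on the points `(1, r)`; then
  -- `S` is empty and any unit vector serves.
  by_cases h0 : (fun l : Fin d => φ (Pi.single l.succ 1)) = 0
  · refine ⟨0, Pi.single ⟨0, hd⟩ 1, by simp [Pi.norm_single], fun r hr => absurd ?_ hφ⟩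
    have h3 : ∀ l : Fin d, φ (Pi.single l.succ 1) = 0 := congrFun h0
    have h4 := h2 r hr
    simp only [h3, zero_mul, Finset.sum_const_zero, add_zero] at h4
    refine LinearMap.ext fun v => ?_
    simp [h1 v, h3, h4]
  · set a := fun l : Fin d => φ (Pi.single l.succ 1) with ha
    refine ⟨‖a‖⁻¹ * φ (Pi.single 0 1), ‖a‖⁻¹ • a, ?_, fun r hr => ?_⟩
    · rw [norm_smul, norm_inv, norm_norm, inv_mul_cancel₀ (norm_ne_zero_iff.2 h0)]
    · simp only [Pi.smul_apply, smul_eq_mul, mul_assoc]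
      rw [← Finset.mul_sum, ← mul_add, h2 r hr, mul_zero]

/-- Rational points of height less than a constant times `ρ ^ (-N / (d + 1))` whose parameters lie
in a ball of radius `ρ` are contained in a common affine hyperplane. -/
theorem exists_const_rational_points_on_hyperplane {k d : ℕ} (hk : 1 ≤ k) (hd : 1 ≤ d)
    {U : Set (Fin k → ℝ)} {Ψ : (Fin k → ℝ) → Fin d → ℝ} (hU : IsOpen U)
    (hΨ : ContDiffOn ℝ ∞ Ψ U) (C : ℝ) :
    ∃ Y : ℝ, 0 < Y ∧ ∀ (x : Fin k → ℝ) (ρ : ℝ), 0 < ρ → ρ ≤ 1 → Metric.closedBall x ρ ⊆ U →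
      (∀ u ∈ Metric.closedBall x ρ, ∀ l, ∀ s : List (Fin k), s.length ≤ nkd k d + 1 →
        |pd s (fun v => Ψ v l) u| ≤ C) →
      ∃ (b : ℝ) (a : Fin d → ℝ), ‖a‖ = 1 ∧ ∀ r : Fin d → ℚ,
        ∀ z ∈ Metric.closedBall x ρ, Ψ z = ratPoint r →
        Y * ρ ^ Nkd k d * (height r : ℝ) ^ (d + 1) < 1 → b + ∑ l, a l * Ψ z l = 0 := by
  -- The summand `1` covers the coefficient of the constant first coordinate.
  let C' : ℝ := (k + 1) ^ (nkd k d + 1) * |C| + 1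
  have hC' : 1 ≤ C' := by
    have : 0 ≤ (k + 1 : ℝ) ^ (nkd k d + 1) * |C| := by positivity
    simp only [C']
    linarith
  refine ⟨(Fintype.card (Mon k (nkd k d)) + 1) ^ (d + 1) * ((d + 1).factorial * C' ^ (d + 1)),
    by positivity, fun x ρ hρ hρ1 hxU hC => ?_⟩
  set Y := (Fintype.card (Mon k (nkd k d)) + 1) ^ (d + 1) * ((d + 1).factorial * C' ^ (d + 1))
  have hx : x ∈ Metric.closedBall x ρ := Metric.mem_closedBall_self hρ.le
  have hT : ∀ l : Fin (d + 1), ∃ c : Mon k (nkd k d) → ℝ, (∀ o, |c o| ≤ C') ∧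
      ∀ u ∈ Metric.closedBall x ρ, |(Fin.cons 1 (Ψ u) : Fin (d + 1) → ℝ) l -
        ∑ o, c o * o.eval (u - x)| ≤ C' * ρ ^ (nkd k d + 1) := by
    intro l
    refine Fin.cases ?_ (fun l => ?_) l
    · refine ⟨fun o => if o = ⟨0, Sym.nil⟩ then 1 else 0, fun o => ?_, fun u _ => ?_⟩
      · beta_reduce
        split_ifs <;> simp <;> linarith
      · simp only [ite_mul, one_mul, zero_mul, Finset.sum_ite_eq', Finset.mem_univ, if_true]
        simp only [Fin.cons_zero, Mon.eval]
        have : ((Sym.nil : Sym (Fin k) 0) : Multiset (Fin k)) = 0 := rfl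
        simp only [Fin.val_zero, this]
        simp
        positivity
    · have hΨl : ContDiffOn ℝ ∞ (fun v => Ψ v l) U := contDiffOn_pi.1 hΨ l
      obtain ⟨c, hc1, hc2⟩ := exists_taylor_expansion hU hΨl (convex_closedBall x ρ) hxU
        (fun u hu s hs => hC u hu l s hs) hx
      have h1 : (k + 1 : ℝ) ^ (nkd k d + 1) * C ≤ C' := by
        have : (k + 1 : ℝ) ^ (nkd k d + 1) * C ≤ (k + 1 : ℝ) ^ (nkd k d + 1) * |C| := by
          gcongr
          exact le_abs_self C
        simp only [C']
        linarith
      refine ⟨c, fun o => (hc1 o).trans h1, fun u hu => ?_⟩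
      rw [Fin.cons_succ]
      refine (hc2 u hu).trans ?_
      have h2 : ‖u - x‖ ≤ ρ := mem_closedBall_iff_norm.1 hu
      gcongr
  choose c hc1 hc2 using hT
  let S : Set (Fin d → ℚ) := {r | (∃ z ∈ Metric.closedBall x ρ, Ψ z = ratPoint r) ∧
    Y * ρ ^ Nkd k d * (height r : ℝ) ^ (d + 1) < 1}
  have hdet : ∀ r : Fin (d + 1) → Fin d → ℚ, (∀ i, r i ∈ S) → |Matrix.det
      (Matrix.of fun i => (Fin.cons 1 (ratPoint (r i)) : Fin (d + 1) → ℝ))| ≤ Y * ρ ^ Nkd k d := by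
    intro r hr
    choose z hz hzr using fun i => (hr i).1
    refine abs_det_taylor_le hk (Nkd_add_sum k d) hρ hρ1 hc1 (h := fun i => z i - x)
      (fun i => mem_closedBall_iff_norm.1 (hz i)) fun i l => ?_
    rw [Matrix.of_apply, ← hzr]
    exact hc2 l (z i) (hz i)
  obtain ⟨b, a, ha, hab⟩ := exists_affine_of_abs_det_le hd hdet fun r hr => hr.2
  refine ⟨b, a, ha, fun r z hz hzr hr => ?_⟩
  rw [hzr]
  exact hab r ⟨⟨z, hz, hzr⟩, hr⟩

open Filter Topology Asymptotics

/-! ### Nondegeneracy does not depend on the local parameterization -/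

section FiniteDifferences

variable {k : ℕ} {U : Set (Fin k → ℝ)} {f g : (Fin k → ℝ) → ℝ}

theorem exists_abs_pd_le (hU : IsOpen U) {d : ℕ} {F : Fin d → (Fin k → ℝ) → ℝ}
    (hF : ∀ l, ContDiffOn ℝ ∞ (F l) U) {K : Set (Fin k → ℝ)} (hK : IsCompact K) (hKU : K ⊆ U)
    (n : ℕ) : ∃ C : ℝ, 0 < C ∧ ∀ l, ∀ s : List (Fin k), s.length ≤ n → ∀ u ∈ K,
      |pd s (F l) u| ≤ C := by
  have h1 : ∀ s : List (Fin k), ∀ l, ∃ C : ℝ, ∀ u ∈ K, |pd s (F l) u| ≤ C := fun s l =>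
    hK.exists_bound_of_continuousOn ((contDiffOn_pd hU (hF l) s).continuousOn.mono hKU)
  choose C hC using h1
  have h2 : (Set.univ ×ˢ {s : List (Fin k) | s.length ≤ n} : Set (Fin d × List (Fin k))).Finite :=
    Set.finite_univ.prod (List.finite_length_le _ _)
  obtain ⟨B, hB⟩ := (h2.image fun q => C q.2 q.1).bddAbove
  refine ⟨max B 1, by positivity, fun l s hs u hu => ?_⟩
  exact (hC s l u hu).trans ((hB ⟨(l, s), ⟨trivial, hs⟩, rfl⟩).trans (le_max_left _ _))

theorem pd_comp_add_right (s : List (Fin k)) (w : Fin k → ℝ) :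
    pd s (fun u => f (u + w)) = fun u => pd s f (u + w) := by
  induction s with
  | nil => rfl
  | cons i s ih =>
    ext u
    simp only [pd, ih]
    rw [fderiv_comp_add_right]

theorem pd_sub (hU : IsOpen U) (hf : ContDiffOn ℝ ∞ f U) (hg : ContDiffOn ℝ ∞ g U)
    (s : List (Fin k)) {u : Fin k → ℝ} (hu : u ∈ U) :
    pd s (fun v => f v - g v) u = pd s f u - pd s g u := by
  induction s generalizing u with
  | nil => rfl
  | cons i s ih =>
    have h1 : pd s (fun v => f v - g v) =ᶠ[𝓝 u] fun v => pd s f v - pd s g v := by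
      filter_upwards [hU.mem_nhds hu] with v hv using ih hv
    simp only [pd, h1.fderiv_eq]
    rw [fderiv_fun_sub (differentiableAt_pd hU hf s hu) (differentiableAt_pd hU hg s hu)]
    rfl

/-- The iterated finite difference of `f` in the coordinate directions listed in `s`. -/
def fdiff (t : ℝ) : List (Fin k) → ((Fin k → ℝ) → ℝ) → (Fin k → ℝ) → ℝ
  | [], f => f
  | i :: s, f => fdiff t s fun u => f (u + Pi.single i t) - f u

theorem add_single_mem_closedBall {v u : Fin k → ℝ} {i : Fin k} {t r : ℝ} (ht : 0 ≤ t)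
    (hu : u ∈ Metric.closedBall v r) : u + Pi.single i t ∈ Metric.closedBall v (r + t) := by
  rw [mem_closedBall_iff_norm] at hu ⊢
  rw [add_sub_right_comm]
  refine (norm_add_le _ _).trans (add_le_add hu ?_)
  simp [Pi.norm_single, abs_of_nonneg ht]

theorem abs_fdiff_le {t C : ℝ} (ht : 0 ≤ t) (s : List (Fin k)) {v : Fin k → ℝ}
    (h : ∀ u ∈ Metric.closedBall v (s.length * t), |f u| ≤ C) :
    |fdiff t s f v| ≤ 2 ^ s.length * C := by
  induction s generalizing f C with
  | nil => simpa [fdiff] using h v (by simp)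
  | cons i s ih =>
    have h1 : ((i :: s).length : ℝ) * t = s.length * t + t := by
      push_cast [List.length_cons]; ring
    rw [h1] at h
    rw [List.length_cons, pow_succ, mul_assoc]
    refine ih (f := fun u => f (u + Pi.single i t) - f u) fun u hu => ?_
    have h2 := h _ (add_single_mem_closedBall (i := i) ht hu)
    have h3 := h u (Metric.closedBall_subset_closedBall (by linarith) hu)
    refine (abs_sub _ _).trans ?_
    linarith

/-- Iterated mean value theorem. The induction varies `U`, because a difference is smooth only where
both `f` and its translate are. -/
theorem exists_fdiff_eq {t : ℝ} (ht : 0 < t) (s : List (Fin k)) (hU : IsOpen U)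
    (hf : ContDiffOn ℝ ∞ f U) {v : Fin k → ℝ} (hv : Metric.closedBall v (s.length * t) ⊆ U) :
    ∃ ξ ∈ Metric.closedBall v (s.length * t), fdiff t s f v = t ^ s.length * pd s f ξ := by
  induction s generalizing f U with
  | nil => exact ⟨v, by simp, by simp [fdiff, pd]⟩
  | cons i s ih =>
    have h1 : ((i :: s).length : ℝ) * t = s.length * t + t := by
      push_cast [List.length_cons]; ring
    rw [h1] at hv ⊢
    let τ : (Fin k → ℝ) → (Fin k → ℝ) := fun u => u + Pi.single i t
    have hτ : ContDiff ℝ ∞ τ := contDiff_id.add contDiff_const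
    have hU' : IsOpen (U ∩ τ ⁻¹' U) := hU.inter (hU.preimage hτ.continuous)
    have hf1 : ContDiffOn ℝ ∞ f (U ∩ τ ⁻¹' U) := hf.mono Set.inter_subset_left
    have hf2 : ContDiffOn ℝ ∞ (fun u => f (u + Pi.single i t)) (U ∩ τ ⁻¹' U) :=
      hf.comp hτ.contDiffOn fun u hu => hu.2
    have hsub : Metric.closedBall v (s.length * t) ⊆ U ∩ τ ⁻¹' U := fun u hu =>
      ⟨hv (Metric.closedBall_subset_closedBall (by linarith) hu),
        hv (add_single_mem_closedBall ht.le hu)⟩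
    obtain ⟨ξ, hξ, hξ'⟩ := ih hU' (hf2.sub hf1) hsub
    have h2 : fdiff t (i :: s) f v = t ^ s.length * (pd s f (ξ + Pi.single i t) - pd s f ξ) := by
      rw [fdiff]
      refine hξ'.trans ?_
      rw [pd_sub hU' hf2 hf1 s (hsub hξ), pd_comp_add_right]
    have h3 : ∀ r ∈ Set.Icc 0 t, ξ + Pi.single i r ∈ Metric.closedBall v (s.length * t + t) :=
      fun r hr => Metric.closedBall_subset_closedBall (by linarith [hr.2])
        (add_single_mem_closedBall hr.1 hξ)
    have h4 : ∀ r ∈ Set.Icc 0 t, HasDerivAt (fun r => pd s f (ξ + Pi.single i r))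
        (pd (i :: s) f (ξ + Pi.single i r)) r := by
      intro r hr
      have h5 : HasDerivAt (fun r : ℝ => ξ + Pi.single i r) (Pi.single i 1) r := by
        have := ((hasDerivAt_id r).smul_const (Pi.single i 1 : Fin k → ℝ)).const_add ξ
        simpa [← Pi.single_smul] using this
      exact (differentiableAt_pd hU hf s (hv (h3 r hr))).hasFDerivAt.comp_hasDerivAt r h5
    obtain ⟨r, hr, hr'⟩ := exists_hasDerivAt_eq_slope _ _ ht
      (fun r hr => (h4 r hr).continuousAt.continuousWithinAt)
      (fun r hr => h4 r (Set.Ioo_subset_Icc_self hr))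
    refine ⟨_, h3 r (Set.Ioo_subset_Icc_self hr), ?_⟩
    rw [h2, hr', List.length_cons, pow_succ]
    simp only [Pi.single_zero, add_zero, sub_zero]
    field_simp

/-- The finite difference with step `t` is `t ^ s.length` times the derivative at a point near `v`,
and it is also `O(t ^ (n + 1))`. Dividing, the derivative tends to zero as `t` does. -/
theorem pd_eq_zero_of_isBigO (hU : IsOpen U) (hf : ContDiffOn ℝ ∞ f U) {v : Fin k → ℝ}
    (hv : v ∈ U) {n : ℕ} (h : f =O[𝓝 v] fun u => ‖u - v‖ ^ (n + 1)) {s : List (Fin k)}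
    (hs : s.length ≤ n) : pd s f v = 0 := by
  obtain ⟨C, hC0, hC⟩ := h.exists_pos
  rw [isBigOWith_iff] at hC
  by_contra hne
  have hcont : ContinuousAt (fun u => |pd s f u|) v :=
    ((contDiffOn_pd hU hf s).continuousOn.continuousAt (hU.mem_nhds hv)).abs
  have h1 : ∀ᶠ u in 𝓝 v, |pd s f v| / 2 < |pd s f u| :=
    hcont.eventually (lt_mem_nhds (half_lt_self (abs_pos.2 hne)))
  obtain ⟨ε, hε, hε'⟩ := Metric.eventually_nhds_iff_ball.1 (hC.and (h1.and (hU.mem_nhds hv)))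
  let K : ℝ := 2 ^ s.length * (C * (s.length : ℝ) ^ (n + 1))
  have h2 : ∀ᶠ t : ℝ in 𝓝[>] 0, s.length * t < ε := by
    have : Tendsto (fun t : ℝ => s.length * t) (𝓝[>] 0) (𝓝 (s.length * 0)) :=
      (continuous_const.mul continuous_id).continuousAt.tendsto.mono_left nhdsWithin_le_nhds
    exact this.eventually (gt_mem_nhds (by simpa using hε))
  have h3 : ∀ᶠ t : ℝ in 𝓝[>] 0, K * t < |pd s f v| / 2 := by
    have : Tendsto (fun t : ℝ => K * t) (𝓝[>] 0) (𝓝 (K * 0)) :=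
      (continuous_const.mul continuous_id).continuousAt.tendsto.mono_left nhdsWithin_le_nhds
    exact this.eventually (gt_mem_nhds (by simpa using abs_pos.2 hne))
  have h4 : ∀ᶠ t : ℝ in 𝓝[>] 0, t < 1 := (gt_mem_nhds one_pos).filter_mono nhdsWithin_le_nhds
  obtain ⟨t, ht2, ht3, ht1, ht0⟩ := (h2.and (h3.and (h4.and self_mem_nhdsWithin))).exists
  have ht0 : 0 < t := ht0
  have hball : Metric.closedBall v (s.length * t) ⊆ Metric.ball v ε :=
    Metric.closedBall_subset_ball ht2
  obtain ⟨ξ, hξ, hξ'⟩ := exists_fdiff_eq ht0 s hU hf fun u hu => (hε' u (hball hu)).2.2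
  have h5 := abs_fdiff_le (f := f) (C := C * (s.length * t) ^ (n + 1)) ht0.le s fun u hu => by
    refine ((hε' u (hball hu)).1).trans ?_
    rw [norm_pow, norm_norm]
    have := mem_closedBall_iff_norm.1 hu
    gcongr
  rw [hξ', abs_mul, abs_of_pos (by positivity)] at h5
  have h6 := (hε' ξ (hball hξ)).2.1
  have h7 : 2 ^ s.length * (C * (s.length * t) ^ (n + 1)) ≤ t ^ s.length * (K * t) := by
    have : t ^ (n + 1) ≤ t ^ (s.length + 1) := pow_le_pow_of_le_one ht0.le ht1.le (by omega)
    calc 2 ^ s.length * (C * (s.length * t) ^ (n + 1)) = K * t ^ (n + 1) := by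
          simp only [K]; ring
      _ ≤ K * t ^ (s.length + 1) := by
          refine mul_le_mul_of_nonneg_left this ?_
          positivity
      _ = _ := by ring
  have h8 := le_of_mul_le_mul_left (h5.trans h7) (by positivity)
  linarith

end FiniteDifferences

/-! ### Order of contact with hyperplanes, read on `M` itself. -/

section LocalParam

variable {k d : ℕ} {M : Set (Fin d → ℝ)} {U : Set (Fin k → ℝ)} {Ψ : (Fin k → ℝ) → (Fin d → ℝ)}

theorem IsLocalParam.map_nhds (hΨ : IsLocalParam M U Ψ) {v : Fin k → ℝ} (hv : v ∈ U) :
    map Ψ (𝓝 v) = 𝓝[M] (Ψ v) := by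
  obtain ⟨O, hO, hO'⟩ := hΨ.image_relatively_open
  have h1 := hΨ.isEmbedding.map_nhds_eq ⟨v, hv⟩
  have h2 : Set.range (U.domRestrict Ψ) = M ∩ O := by rw [← hO', Set.range_domRestrict]
  have hvO : Ψ v ∈ O := by
    have : Ψ v ∈ M ∩ O := hO' ▸ Set.mem_image_of_mem Ψ hv
    exact this.2
  rw [h2] at h1
  have h3 : 𝓝[M ∩ O] (Ψ v) = 𝓝[M] (Ψ v) := nhdsWithin_inter_of_mem' (mem_nhdsWithin_of_mem_nhds (hO.mem_nhds hvO))
  rw [← h3]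
  refine Eq.trans ?_ h1
  rw [← map_nhds_subtype_coe_eq_nhds hv (hΨ.isOpen_domain.mem_nhds hv), map_map]
  rfl

theorem IsLocalParam.contDiffOn_apply (hΨ : IsLocalParam M U Ψ) (l : Fin d) :
    ContDiffOn ℝ ∞ (fun u => Ψ u l) U := contDiffOn_pi.1 hΨ.contDiffOn l

theorem IsLocalParam.hasFDerivAt (hΨ : IsLocalParam M U Ψ) {v : Fin k → ℝ} (hv : v ∈ U) :
    HasFDerivAt Ψ (fderiv ℝ Ψ v) v :=
  ((hΨ.contDiffOn.contDiffAt (hΨ.isOpen_domain.mem_nhds hv)).differentiableAt (by simp)).hasFDerivAt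

theorem IsLocalParam.isBigO_sub_rev (hΨ : IsLocalParam M U Ψ) {v : Fin k → ℝ} (hv : v ∈ U) :
    (fun u => u - v) =O[𝓝 v] fun u => Ψ u - Ψ v := by
  obtain ⟨K, -, hK⟩ := LinearMap.exists_antilipschitzWith (fderiv ℝ Ψ v).toLinearMap
    (LinearMap.ker_eq_bot.2 (hΨ.injective_fderiv v hv))
  exact ((hΨ.hasFDerivAt hv).isTheta_sub
    (hK.isUniformInducing (fderiv ℝ Ψ v).uniformContinuous).isInducing).isBigO_symm

theorem IsLocalParam.contDiffOn_affine (hΨ : IsLocalParam M U Ψ) (a : Fin d → ℝ) (b : ℝ) :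
    ContDiffOn ℝ ∞ (fun u => b + ∑ l, a l * Ψ u l) U :=
  contDiffOn_const.add (ContDiffOn.sum fun l _ => contDiffOn_const.mul (hΨ.contDiffOn_apply l))

/-- Taylor's formula turns vanishing derivatives into an order of vanishing along `M`, a condition
free of the parameterization. With the converse below it carries nondegeneracy from one
parameterization to another. -/
theorem IsLocalParam.isBigO_of_pd_eq_zero (hΨ : IsLocalParam M U Ψ) {v : Fin k → ℝ} (hv : v ∈ U)
    {a : Fin d → ℝ} {D : ℕ} (h : ∀ s : List (Fin k), s ≠ [] → s.length ≤ D →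
      ∑ l, a l * pd s (fun u => Ψ u l) v = 0) :
    (fun y => ∑ l, a l * (y l - Ψ v l)) =O[𝓝[M] (Ψ v)] fun y => ‖y - Ψ v‖ ^ (D + 1) := by
  have hU := hΨ.isOpen_domain
  let f : (Fin k → ℝ) → ℝ := fun u => -∑ l, a l * Ψ v l + ∑ l, a l * Ψ u l
  have hf : ContDiffOn ℝ ∞ f U := hΨ.contDiffOn_affine a _
  have hfe : ∀ u, f u = ∑ l, a l * (Ψ u l - Ψ v l) := fun u => by
    simp only [f, mul_sub, Finset.sum_sub_distrib]
    ring
  obtain ⟨ε, hε, hεU⟩ := Metric.nhds_basis_closedBall.mem_iff.1 (hU.mem_nhds hv)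
  obtain ⟨C, hC0, hC⟩ := exists_abs_pd_le hU (F := fun _ : Fin 1 => f) (fun _ => hf)
    (isCompact_closedBall v ε) hεU (D + 1)
  have h1 : f =O[𝓝 v] fun u => ‖u - v‖ ^ (D + 1) := by
    refine IsBigO.of_bound (k ^ (D + 1) * C) ?_
    filter_upwards [Metric.closedBall_mem_nhds v hε] with u hu
    have h2 := abs_sub_taylor_pd_le hU hf (convex_closedBall v ε) hεU (n := D)
      (fun w hw s => hC 0 (List.ofFn s) (by simp) w hw) (Metric.mem_closedBall_self hε.le) hu
    rw [Finset.sum_eq_zero, sub_zero] at h2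
    · simpa using h2
    · intro j hj
      refine Finset.sum_eq_zero fun s _ => ?_
      have h3 : pd (List.ofFn s) f v = 0 := by
        rw [pd_affine hU hΨ.contDiffOn_apply a _ _ hv]
        by_cases hj0 : List.ofFn s = []
        · simp [hj0, pd]
        · rw [if_neg hj0, zero_add]
          refine h _ hj0 ?_
          have := Finset.mem_range.1 hj
          simp only [List.length_ofFn]
          omega
      rw [h3, zero_div, mul_zero]
  rw [← hΨ.map_nhds hv, isBigO_map]
  have h2 : (fun u => ‖u - v‖ ^ (D + 1)) =O[𝓝 v] fun u => ‖Ψ u - Ψ v‖ ^ (D + 1) :=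
    (hΨ.isBigO_sub_rev hv).norm_norm.pow _
  exact (h1.trans h2).congr_left hfe

theorem IsLocalParam.pd_eq_zero_of_isBigO (hΨ : IsLocalParam M U Ψ) {v : Fin k → ℝ} (hv : v ∈ U)
    {a : Fin d → ℝ} {D : ℕ}
    (h : (fun y => ∑ l, a l * (y l - Ψ v l)) =O[𝓝[M] (Ψ v)] fun y => ‖y - Ψ v‖ ^ (D + 1))
    {s : List (Fin k)} (hs0 : s ≠ []) (hs : s.length ≤ D) :
    ∑ l, a l * pd s (fun u => Ψ u l) v = 0 := by
  have hU := hΨ.isOpen_domain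
  let f : (Fin k → ℝ) → ℝ := fun u => -∑ l, a l * Ψ v l + ∑ l, a l * Ψ u l
  have hf : ContDiffOn ℝ ∞ f U := hΨ.contDiffOn_affine a _
  have hfe : ∀ u, ∑ l, a l * (Ψ u l - Ψ v l) = f u := fun u => by
    simp only [f, mul_sub, Finset.sum_sub_distrib]
    ring
  rw [← hΨ.map_nhds hv, isBigO_map] at h
  have h2 : (fun u => ‖Ψ u - Ψ v‖ ^ (D + 1)) =O[𝓝 v] fun u => ‖u - v‖ ^ (D + 1) :=
    (hΨ.hasFDerivAt hv).isBigO_sub.norm_norm.pow _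
  have h3 := IntrinsicApprox.pd_eq_zero_of_isBigO hU hf hv ((h.congr_left hfe).trans h2) hs
  rw [pd_affine hU hΨ.contDiffOn_apply a _ _ hv, if_neg hs0, zero_add] at h3
  exact h3

theorem IsLocalParam.exists_pd_ne_zero (hΨ : IsLocalParam M U Ψ) {v : Fin k → ℝ} (hv : v ∈ U)
    {D : ℕ} (hD : IsNondegenerateAt k M D (Ψ v)) {a : Fin d → ℝ} (ha : a ≠ 0) :
    ∃ s : List (Fin k), s ≠ [] ∧ s.length ≤ D ∧ ∑ l, a l * pd s (fun u => Ψ u l) v ≠ 0 := by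
  by_contra! hc
  obtain ⟨V, Φ, w, hΦ, hw, hwv, hspan⟩ := hD
  have h1 := hΨ.isBigO_of_pd_eq_zero hv hc
  rw [← hwv] at h1
  let φ : (Fin d → ℝ) →ₗ[ℝ] ℝ := ∑ l, a l • LinearMap.proj l
  have hφ : ∀ y, φ y = ∑ l, a l * y l := fun y => by simp [φ]
  have h2 : partialsSpan Φ w D ≤ LinearMap.ker φ := by
    refine Submodule.span_le.2 ?_
    rintro y ⟨i, hi0, hiD, s, rfl⟩
    have h3 := hΦ.pd_eq_zero_of_isBigO hw h1 (s := List.ofFn s)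
      (by simpa [List.ofFn_eq_nil_iff] using hi0.ne') (by simpa using hiD)
    rw [SetLike.mem_coe, LinearMap.mem_ker, hφ, ← h3]
    refine Finset.sum_congr rfl fun l _ => ?_
    rw [pd_ofFn_eq_iteratedFDeriv hΦ.isOpen_domain hΦ.contDiffOn l s hw]
  rw [hspan, top_le_iff] at h2
  refine ha (funext fun l => ?_)
  have h3 : φ (Pi.single l 1) = 0 := by
    rw [← LinearMap.mem_ker, h2]
    trivial
  simpa [hφ, Pi.single_apply] using h3

/-- A quantitative form of nondegeneracy that is uniform on compact sets. -/
theorem IsLocalParam.exists_le_sum_abs_pd (hΨ : IsLocalParam M U Ψ) {D : ℕ}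
    (hD : ∀ x ∈ M, IsNondegenerateAt k M D x) {K : Set (Fin k → ℝ)} (hK : IsCompact K)
    (hKU : K ⊆ U) : ∃ δ : ℝ, 0 < δ ∧ ∀ v ∈ K, ∀ a : Fin d → ℝ, ‖a‖ = 1 →
      ∃ s : List (Fin k), s ≠ [] ∧ s.length ≤ D ∧ δ ≤ |∑ l, a l * pd s (fun u => Ψ u l) v| := by
  have hfin : {s : List (Fin k) | s ≠ [] ∧ s.length ≤ D}.Finite :=
    (List.finite_length_le _ D).subset fun s hs => hs.2
  -- The sum over all words is continuous and positive on the compact set `K × sphere`; its minimum,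
  -- shared among the words, yields `δ`.
  let G : (Fin k → ℝ) × (Fin d → ℝ) → ℝ := fun q =>
    ∑ s ∈ hfin.toFinset, |∑ l, q.2 l * pd s (fun u => Ψ u l) q.1|
  have hG : ContinuousOn G (K ×ˢ Metric.sphere 0 1) := by
    refine continuousOn_finsetSum _ fun s _ => ContinuousOn.abs
      (continuousOn_finsetSum _ fun l _ => ContinuousOn.mul ?_ ?_)
    · exact ((continuous_apply l).comp continuous_snd).continuousOn
    · exact ((contDiffOn_pd hΨ.isOpen_domain (hΨ.contDiffOn_apply l) s).continuousOn.mono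
        hKU).comp continuous_fst.continuousOn fun q hq => hq.1
  have hpos : ∀ q ∈ K ×ˢ Metric.sphere (0 : Fin d → ℝ) 1, 0 < G q := by
    rintro ⟨v, a⟩ ⟨hv, ha⟩
    have ha0 : a ≠ 0 := by
      rintro rfl
      simp at ha
    have hM : Ψ v ∈ M := by
      obtain ⟨O, -, hO⟩ := hΨ.image_relatively_open
      exact (hO ▸ Set.mem_image_of_mem Ψ (hKU hv) : Ψ v ∈ M ∩ O).1
    obtain ⟨s, hs1, hs2, hs3⟩ := hΨ.exists_pd_ne_zero (hKU hv) (hD _ hM) ha0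
    exact Finset.sum_pos' (fun _ _ => abs_nonneg _)
      ⟨s, hfin.mem_toFinset.2 ⟨hs1, hs2⟩, abs_pos.2 hs3⟩
  obtain ⟨δ, hδ, hδG⟩ : ∃ δ : ℝ, 0 < δ ∧ ∀ q ∈ K ×ˢ Metric.sphere (0 : Fin d → ℝ) 1, δ ≤ G q := by
    rcases (K ×ˢ Metric.sphere (0 : Fin d → ℝ) 1).eq_empty_or_nonempty with he | hne
    · exact ⟨1, one_pos, by simp [he]⟩
    · obtain ⟨q, hq, hmin⟩ := (hK.prod (isCompact_sphere _ _)).exists_isMinOn hne hG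
      exact ⟨G q, hpos q hq, fun q' hq' => hmin hq'⟩
  refine ⟨δ / (hfin.toFinset.card + 1), by positivity, fun v hv a ha => ?_⟩
  by_contra! hc
  have h1 := hδG (v, a) ⟨hv, by simpa using ha⟩
  have h2 : G (v, a) ≤ hfin.toFinset.card * (δ / (hfin.toFinset.card + 1)) := by
    rw [← nsmul_eq_mul]
    refine Finset.sum_le_card_nsmul _ _ _ fun s hs => ?_
    have := hfin.mem_toFinset.1 hs
    exact (hc s this.1 this.2).le
  have h3 : hfin.toFinset.card * (δ / (hfin.toFinset.card + 1)) < δ := by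
    rw [mul_div_assoc', div_lt_iff₀ (by positivity)]
    linarith
  linarith

end LocalParam

/-! ### Avoiding the zero set of a nondegenerate function -/

section Avoid

variable {k : ℕ} {β : ℝ}

/-- Alice plays the zero set of the affine function. Where the value is small, a short move along
coordinate `i` reaches that set, so the point was deleted. -/
theorem force_linear {B : (Fin k → ℝ) × ℝ} (hβ : 0 < β) (hB : 0 < B.2) {p : Fin k → ℝ} {c a : ℝ}
    (ha : 0 < a) {i : Fin k} (hi : a ≤ |p i|) :
    Force β (fun B' => ∀ u ∈ ballSet B', a * (β * B.2) ≤ |c + ∑ j, (u j - B.1 j) * p j|) 1 B := by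
  have hpi : p i ≠ 0 := abs_pos.1 (ha.trans_le hi)
  refine ⟨_, ⟨p, ∑ j, p j * B.1 j - c, fun h => hpi (congrFun h i), rfl⟩, fun B' hB' u hu => ?_⟩
  by_contra! hlt
  refine (hB'.2.1 hu).2 ?_
  set ℓ := c + ∑ j, (u j - B.1 j) * p j with hℓ
  refine Metric.mem_cthickening_of_dist_le u (u + Pi.single i (-ℓ / p i)) _ _ ?_ ?_
  · have h1 : ∑ j, p j * (Pi.single i (-ℓ / p i) : Fin k → ℝ) j = -ℓ := by
      rw [Finset.sum_eq_single i (fun j _ hj => by simp [hj]) (by simp)]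
      rw [Pi.single_eq_same, mul_div_cancel₀ _ hpi]
    have h2 : ∑ j, p j * u j - ∑ j, p j * B.1 j = ℓ - c := by
      rw [hℓ, ← Finset.sum_sub_distrib, add_sub_cancel_left]
      exact Finset.sum_congr rfl fun j _ => by ring
    simp only [Set.mem_ofPred_eq, Pi.add_apply, mul_add, Finset.sum_add_distrib, h1]
    linarith
  · rw [dist_self_add_right, Pi.norm_single, Real.norm_eq_abs, abs_div, abs_neg,
      div_le_iff₀ (ha.trans_le hi)]
    have : a * (β * B.2) ≤ |p i| * (β * B.2) := by gcongr
    linarith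

/-- If some partial derivative of `f` of order `j` is bounded below then Alice can force `f` itself
to be bounded below. -/
theorem exists_force_abs_ge (hβ : 0 < β) (i₀ : Fin k) (D : ℕ) {C : ℝ} (j : ℕ) (hj : j ≤ D)
    {c τ : ℝ} (hc : 0 < c) (hτ : 0 < τ) :
    ∃ (m : ℕ) (c' : ℝ), 0 < c' ∧ ∀ (U W : Set (Fin k → ℝ)) (f : (Fin k → ℝ) → ℝ) (Λ ρ₀ : ℝ)
      (B : (Fin k → ℝ) × ℝ) (s : List (Fin k)), IsOpen U → ContDiffOn ℝ ∞ f U → W ⊆ U →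
      0 < Λ → 0 < ρ₀ →
      (∀ s : List (Fin k), s ≠ [] → s.length ≤ D + 1 → ∀ u ∈ W,
        ρ₀ ^ s.length * |pd s f u| ≤ C * Λ) →
      ballSet B ⊆ W → τ * ρ₀ ≤ B.2 → B.2 ≤ ρ₀ → s.length = j →
      (∀ u ∈ ballSet B, c * Λ ≤ ρ₀ ^ j * |pd s f u|) →
      Force β (fun B' => ∀ u ∈ ballSet B', c' * Λ ≤ |f u|) m B := by
  induction j generalizing c τ with
  | zero =>
    refine ⟨0, c, hc, fun U W f Λ ρ₀ B s _ _ _ _ _ _ _ _ _ hs h => ?_⟩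
    rw [List.length_eq_zero_iff] at hs
    simpa [Force, hs, pd] using h
  | succ j ih =>
    -- After `w` halvings the quadratic Taylor error is at most half of the lower bound obtained for
    -- the linear part.
    obtain ⟨w, hw⟩ := exists_pow_lt_of_lt_one (x := c * β / 2 / (k * (k * |C|) + 1))
      (y := (1 / 2 : ℝ)) (by positivity) (by norm_num)
    have hw' : k * (k * |C|) * (1 / 2) ^ w ≤ c * β / 2 := by
      rw [lt_div_iff₀ (by positivity)] at hw
      have : (0 : ℝ) ≤ (1 / 2) ^ w := by positivity
      nlinarith
    obtain ⟨m, c', hc', H⟩ := ih (by omega) (c := c * β / 2 * (β ^ w * τ))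
      (τ := β * (β ^ w * τ)) (by positivity) (by positivity)
    refine ⟨w + (1 + m), c', hc',
      fun U W f Λ ρ₀ B s hU hf hWU hΛ hρ₀ hup hBW hBτ hBρ hs hlow => ?_⟩
    obtain ⟨i, s, rfl⟩ : ∃ i t, s = i :: t := List.exists_cons_of_length_eq_add_one hs
    have hs' : s.length = j := by simpa using hs
    have hB : 0 < B.2 := (by positivity : 0 < τ * ρ₀).trans_le hBτ
    have hC : 0 ≤ C := by
      have h1 := hup [i] (by simp) (by simp) B.1 (hBW (Metric.mem_closedBall_self hB.le))
      have h2 : 0 ≤ C * Λ := le_trans (by positivity) h1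
      exact nonneg_of_mul_nonneg_left h2 hΛ
    rw [abs_of_nonneg hC] at hw'
    refine Force.bind (((force_shrink i₀ w hB).and_bounds hβ hB).mono ?_)
    rintro B₁ ⟨h1half, h1sub, h1lo, h1pos⟩
    have hx₁ : B₁.1 ∈ ballSet B₁ := Metric.mem_closedBall_self h1pos.le
    have ha : c * Λ / ρ₀ ^ (j + 1) ≤ |pd [i] (pd s f) B₁.1| := by
      rw [div_le_iff₀' (by positivity)]
      exact hlow _ (h1sub hx₁)
    refine Force.bind (((force_linear (c := pd s f B₁.1) (p := fun i => pd [i] (pd s f) B₁.1) hβ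
      h1pos (by positivity) ha).and_bounds hβ h1pos).mono ?_)
    rintro B₂ ⟨hlin, h2sub, h2lo, h2pos⟩
    have h1lo' : β ^ w * τ * ρ₀ ≤ B₁.2 := le_trans (by rw [mul_assoc]; gcongr) h1lo
    have h12 : B₂.2 ≤ B₁.2 := radius_le_of_ballSet_subset i₀ h2pos h2sub
    have h01 : B₁.2 ≤ B.2 := radius_le_of_ballSet_subset i₀ h1pos h1sub
    refine H U W f Λ ρ₀ B₂ s hU hf hWU hΛ hρ₀ hup (h2sub.trans (h1sub.trans hBW)) ?_
      (h12.trans (h01.trans hBρ)) hs' fun u hu => ?_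
    · rw [pow_one] at h2lo
      refine le_trans ?_ h2lo
      rw [mul_assoc]
      gcongr
    · have hconv : Convex ℝ (ballSet B₁) := convex_closedBall _ _
      have hB₁U : ballSet B₁ ⊆ U := h1sub.trans (hBW.trans hWU)
      have hpd : ∀ v ∈ ballSet B₁, ∀ i j' : Fin k,
          |pd [i, j'] (pd s f) v| ≤ C * Λ / ρ₀ ^ (j + 2) := fun v hv i j' => by
        rw [le_div_iff₀' (by positivity)]
        have := hup (i :: j' :: s) (by simp) (by simp only [List.length_cons]; omega) v
          (hBW (h1sub hv))
        simp only [List.length_cons, hs'] at this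
        exact this
      have h3 := abs_sub_linear_le_of_abs_pd_le hconv
        (fun v hv => differentiableAt_pd hU hf s (hB₁U hv))
        (fun i v hv => differentiableAt_pd hU hf (i :: s) (hB₁U hv)) (by positivity) hpd
        hx₁ (h2sub hu)
      have h4 := hlin u hu
      have h5 : ‖u - B₁.1‖ ≤ B₁.2 := mem_closedBall_iff_norm.1 (h2sub hu)
      set θ := B₁.2 / ρ₀ with hθ
      have hθe : B₁.2 = θ * ρ₀ := by rw [hθ, div_mul_cancel₀ _ hρ₀.ne']
      have hθ0 : 0 < θ := by positivity
      have hθ1 : β ^ w * τ ≤ θ := by rw [hθ, le_div_iff₀ hρ₀]; exact h1lo'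
      have hθ2 : θ ≤ (1 / 2) ^ w := by
        rw [hθ, div_le_iff₀ hρ₀, one_div_pow, one_div_mul_eq_div]
        exact h1half.trans (by gcongr)
      have h6 : |pd s f u - pd s f B₁.1 - ∑ i, (u i - B₁.1 i) * pd [i] (pd s f) B₁.1| ≤
          k * (k * (C * Λ / ρ₀ ^ (j + 2))) * B₁.2 ^ 2 := h3.trans (by gcongr)
      have h7 : c * Λ / ρ₀ ^ (j + 1) * (β * B₁.2) - k * (k * (C * Λ / ρ₀ ^ (j + 2))) * B₁.2 ^ 2 ≤
          |pd s f u| := by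
        have := abs_sub_abs_le_abs_sub (pd s f B₁.1 + ∑ i, (u i - B₁.1 i) * pd [i] (pd s f) B₁.1)
          (pd s f u)
        rw [abs_sub_comm, ← sub_sub] at this
        linarith
      have h8 : ρ₀ ^ j * (c * Λ / ρ₀ ^ (j + 1) * (β * B₁.2) -
          k * (k * (C * Λ / ρ₀ ^ (j + 2))) * B₁.2 ^ 2) =
          Λ * θ * (c * β - k * (k * C) * θ) := by
        rw [hθe]
        field_simp
        ring
      calc c * β / 2 * (β ^ w * τ) * Λ ≤ c * β / 2 * θ * Λ := by gcongr
        _ = Λ * θ * (c * β - c * β / 2) := by ring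
        _ ≤ Λ * θ * (c * β - k * (k * C) * θ) := by
          have : k * (k * C) * θ ≤ c * β / 2 := le_trans (by gcongr) hw'
          gcongr
        _ ≤ ρ₀ ^ j * |pd s f u| := by
          rw [← h8]
          gcongr

/-- Alice can force the ball of Bob to stay away from the zero set of a smooth function some
derivative of which does not vanish. -/
theorem exists_force_avoid_zeros (hβ : 0 < β) (i₀ : Fin k) (D : ℕ) {C δ : ℝ} (hC : 0 < C)
    (hδ : 0 < δ) :
    ∃ (m : ℕ) (ε ρs : ℝ), 0 < ε ∧ 0 < ρs ∧ ∀ (U : Set (Fin k → ℝ)) (f : (Fin k → ℝ) → ℝ)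
      (B : (Fin k → ℝ) × ℝ), IsOpen U → ContDiffOn ℝ ∞ f U → 0 < B.2 → B.2 ≤ ρs →
      Metric.closedBall B.1 (2 * B.2) ⊆ U →
      (∀ u ∈ Metric.closedBall B.1 (2 * B.2), ∀ s : List (Fin k), s ≠ [] → s.length ≤ D + 1 →
        |pd s f u| ≤ C) →
      (∀ u ∈ Metric.closedBall B.1 (2 * B.2), ∃ s : List (Fin k), s ≠ [] ∧ s.length ≤ D ∧
        δ ≤ |pd s f u|) →
      Force β (fun B' => ∀ u ∈ ballSet B', ∀ z ∈ Metric.closedBall B.1 (2 * B.2), f z = 0 →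
        ε * B.2 ≤ ‖u - z‖) m B := by
  have hk : (0 : ℝ) < k := by exact_mod_cast i₀.pos
  let C₂ : ℝ := (1 + 4 * k) ^ (D + 1)
  have hC₂ : 0 < C₂ := by positivity
  -- On a ball shrunk `w` times the dominant derivative loses at most half of its value at the
  -- center.
  obtain ⟨w, hw⟩ := exists_pow_lt_of_lt_one (x := 1 / 2 / (k * C₂))
    (y := (1 / 2 : ℝ)) (by positivity) (by norm_num)
  rw [lt_div_iff₀ (by positivity)] at hw
  have hchain := fun j (hj : j ≤ D) => exists_force_abs_ge hβ i₀ D (C := C₂) j hj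
    (c := 1 / 2) (τ := β ^ w) (by norm_num) (by positivity)
  choose! m c' hc' H using hchain
  -- The order of the dominant derivative depends on `f`, so the constants must serve all orders at
  -- once.
  obtain ⟨j₀, hj₀, hmin⟩ := Finset.exists_min_image (Finset.range (D + 1)) c' ⟨0, by simp⟩
  have hcj : 0 < c' j₀ := hc' j₀ (Nat.lt_succ_iff.1 (Finset.mem_range.1 hj₀))
  refine ⟨w + (Finset.range (D + 1)).sup m, c' j₀ / (k * C₂), min 1 (δ / C), by positivity,
    by positivity, fun U f B hU hf hB hBs hBU hup hlow => ?_⟩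
  obtain ⟨hB1, hBδ⟩ := le_min_iff.1 hBs
  rw [le_div_iff₀ hC] at hBδ
  refine Force.bind (((force_shrink i₀ w hB).and_bounds hβ hB).mono ?_)
  rintro B₁ ⟨h1half, h1sub, h1lo, h1pos⟩
  set W := Metric.closedBall B.1 (2 * B.2) with hWdef
  have hBW : ballSet B ⊆ W := Metric.closedBall_subset_closedBall (by linarith)
  have hW : Convex ℝ W := convex_closedBall _ _
  have hx₁ : B₁.1 ∈ ballSet B₁ := Metric.mem_closedBall_self h1pos.le
  have hx₁W : B₁.1 ∈ W := hBW (h1sub hx₁)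
  have hfin : {s : List (Fin k) | s ≠ [] ∧ s.length ≤ D}.Finite :=
    (List.finite_length_le _ D).subset fun s hs => hs.2
  obtain ⟨s₁, hs₁0, hs₁D, hs₁⟩ := hlow _ hx₁W
  obtain ⟨s₀, hs₀, hmax⟩ := hfin.exists_maximalFor
    (fun s => B.2 ^ s.length * |pd s f B₁.1|) _ ⟨s₁, hs₁0, hs₁D⟩
  obtain ⟨hs₀0, hs₀D⟩ := hs₀
  -- The natural size of `f` on the ball is its largest rescaled derivative of order `1` to `D`.
  -- Order `0` is excluded because nothing bounds `f` itself.
  set Λ := B.2 ^ s₀.length * |pd s₀ f B₁.1| with hΛdef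
  have hmax' : ∀ s : List (Fin k), s ≠ [] → s.length ≤ D → B.2 ^ s.length * |pd s f B₁.1| ≤ Λ :=
    fun s hs hsD => (le_total _ _).elim id fun h => hmax ⟨hs, hsD⟩ h
  have hΛδ : B.2 ^ D * δ ≤ Λ := by
    refine le_trans ?_ (hmax' s₁ hs₁0 hs₁D)
    exact mul_le_mul (pow_le_pow_of_le_one hB.le hB1 hs₁D) hs₁ hδ.le (by positivity)
  have hΛ : 0 < Λ := (by positivity : 0 < B.2 ^ D * δ).trans_le hΛδ
  have hmvt : ∀ s : List (Fin k), ∀ A : ℝ, 0 ≤ A →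
      (∀ i, ∀ u ∈ W, B.2 ^ (s.length + 1) * |pd (i :: s) f u| ≤ A) → ∀ u ∈ W, ∀ v ∈ W,
      |pd s f u - pd s f v| ≤ k * (A / B.2 ^ (s.length + 1)) * ‖u - v‖ := by
    intro s A hA hAs u hu v hv
    refine abs_sub_le_of_abs_pd_le hW (fun v hv => differentiableAt_pd hU hf s (hBU hv))
      (by positivity) (fun u hu i => ?_) hv hu
    rw [le_div_iff₀' (by positivity)]
    exact hAs i u hu
  -- Downward induction on the order. At order `D + 1` the choice `B.2 ≤ δ / C` suffices; each lower
  -- order costs a factor `1 + 4 * k`, since `W` has diameter at most `4 * B.2`.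
  have hback : ∀ n : ℕ, ∀ s : List (Fin k), s ≠ [] → s.length + n = D + 1 → ∀ u ∈ W,
      B.2 ^ s.length * |pd s f u| ≤ (1 + 4 * k) ^ n * Λ := by
    intro n
    induction n with
    | zero =>
      intro s hs hsn u hu
      rw [pow_zero, one_mul]
      refine le_trans ?_ hΛδ
      have hsD : s.length = D + 1 := by omega
      have h1 := hup u hu s hs hsD.le
      calc B.2 ^ s.length * |pd s f u| ≤ B.2 ^ (D + 1) * C := by rw [hsD]; gcongr
        _ = B.2 ^ D * (B.2 * C) := by ring
        _ ≤ B.2 ^ D * δ := by gcongr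
    | succ n ih =>
      intro s hs hsn u hu
      have h1 := hmvt s ((1 + 4 * k) ^ n * Λ) (by positivity)
        (fun i u hu => ih (i :: s) (by simp) (by simp only [List.length_cons]; omega) u hu)
        u hu _ hx₁W
      have h2 : ‖u - B₁.1‖ ≤ 4 * B.2 := by
        have h3 := mem_closedBall_iff_norm.1 hu
        have h4 := mem_closedBall_iff_norm.1 hx₁W
        have h5 := norm_sub_le (u - B.1) (B₁.1 - B.1)
        rw [sub_sub_sub_cancel_right] at h5
        linarith
      have h6 : |pd s f u| ≤ |pd s f B₁.1| +
          k * ((1 + 4 * k) ^ n * Λ / B.2 ^ (s.length + 1)) * (4 * B.2) := by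
        have h7 := abs_sub_abs_le_abs_sub (pd s f u) (pd s f B₁.1)
        have h8 : k * ((1 + 4 * k) ^ n * Λ / B.2 ^ (s.length + 1)) * ‖u - B₁.1‖ ≤
          k * ((1 + 4 * k) ^ n * Λ / B.2 ^ (s.length + 1)) * (4 * B.2) := by gcongr
        linarith
      calc B.2 ^ s.length * |pd s f u|
          ≤ B.2 ^ s.length * (|pd s f B₁.1| +
          k * ((1 + 4 * k) ^ n * Λ / B.2 ^ (s.length + 1)) * (4 * B.2)) := by gcongr
        _ = B.2 ^ s.length * |pd s f B₁.1| + 4 * k * (1 + 4 * k) ^ n * Λ := by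
          field_simp
          ring
        _ ≤ Λ + 4 * k * (1 + 4 * k) ^ n * Λ := by
          gcongr
          exact hmax' s hs (by omega)
        _ ≤ (1 + 4 * k) ^ n * Λ + 4 * k * (1 + 4 * k) ^ n * Λ := by
          gcongr
          exact le_mul_of_one_le_left hΛ.le (one_le_pow₀ (by linarith))
        _ = (1 + 4 * k) ^ (n + 1) * Λ := by ring
  have hupΛ : ∀ s : List (Fin k), s ≠ [] → s.length ≤ D + 1 → ∀ u ∈ W,
      B.2 ^ s.length * |pd s f u| ≤ C₂ * Λ := by
    intro s hs hsD u hu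
    refine (hback (D + 1 - s.length) s hs (by omega) u hu).trans ?_
    refine mul_le_mul_of_nonneg_right (pow_le_pow_right₀ (by linarith) (by omega)) hΛ.le
  have hstart : ∀ u ∈ ballSet B₁, 1 / 2 * Λ ≤ B.2 ^ s₀.length * |pd s₀ f u| := by
    intro u hu
    have h1 := hmvt s₀ (C₂ * Λ) (by positivity)
      (fun i u hu => hupΛ (i :: s₀) (by simp) (by simp only [List.length_cons]; omega) u hu)
      _ hx₁W u (hBW (h1sub hu))
    have h2 : ‖B₁.1 - u‖ ≤ (1 / 2) ^ w * B.2 := by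
      rw [← dist_eq_norm, dist_comm, one_div_pow, one_div_mul_eq_div]
      exact (Metric.mem_closedBall.1 hu).trans h1half
    have h3 : B.2 ^ s₀.length * (k * (C₂ * Λ / B.2 ^ (s₀.length + 1)) * ‖B₁.1 - u‖) ≤ 1 / 2 * Λ :=
      calc _ ≤ B.2 ^ s₀.length * (k * (C₂ * Λ / B.2 ^ (s₀.length + 1)) * ((1 / 2) ^ w * B.2)) := by
            gcongr
        _ = (1 / 2) ^ w * (k * C₂) * Λ := by field_simp; ring
        _ ≤ 1 / 2 * Λ := by gcongr
    have h4 := (abs_sub_abs_le_abs_sub (pd s₀ f B₁.1) (pd s₀ f u)).trans h1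
    have h5 := mul_le_mul_of_nonneg_left h4 (by positivity : 0 ≤ B.2 ^ s₀.length)
    rw [mul_sub] at h5
    linarith
  have hforce := H s₀.length hs₀D U W f Λ B.2 B₁ s₀ hU hf hBU hΛ hB hupΛ (h1sub.trans hBW) h1lo
    (radius_le_of_ballSet_subset i₀ h1pos h1sub) rfl hstart
  have hs₀r : s₀.length ∈ Finset.range (D + 1) := Finset.mem_range.2 (by omega)
  refine ((hforce.pad i₀ (fun B B' hBB' h u hu => h u (hBB' hu))
    (Finset.le_sup hs₀r)).and_bounds hβ h1pos).mono ?_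
  rintro B' ⟨hB'f, hB'sub, -, -⟩ u hu z hz hfz
  have h1 := hmvt [] (C₂ * Λ) (by positivity)
    (fun i u hu => hupΛ [i] (by simp) (by simp) u hu) u (hBW (h1sub (hB'sub hu))) z hz
  simp only [pd, hfz, sub_zero, List.length_nil, zero_add, pow_one] at h1
  have h2 : c' j₀ * Λ ≤ c' s₀.length * Λ :=
    mul_le_mul_of_nonneg_right (hmin _ hs₀r) hΛ.le
  have h3 := (h2.trans (hB'f u hu)).trans h1
  have h4 : c' j₀ * Λ * B.2 ≤ k * C₂ * ‖u - z‖ * Λ := by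
    calc c' j₀ * Λ * B.2 ≤ k * (C₂ * Λ / B.2) * ‖u - z‖ * B.2 := by gcongr
      _ = k * C₂ * ‖u - z‖ * Λ := by field_simp
  rw [div_mul_eq_mul_div, div_le_iff₀ (by positivity)]
  refine le_of_mul_le_mul_right ?_ hΛ
  linarith

end Avoid

/-! ### Badly intrinsically approximable points are hyperplane winning -/

theorem psi_le_one {c t : ℝ} (hc : 0 ≤ c) (ht : 1 ≤ t) : psi c t ≤ 1 := by
  have := Real.one_le_rpow ht hc
  rw [psi, div_le_one (by linarith)]
  exact this

/-- Every height is matched by a scale of a sequence of scales with bounded ratios. -/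
theorem exists_scale {ρ : ℕ → ℝ} {γ Y : ℝ} {N d : ℕ} (hN : 0 < N) (hρ : ∀ q, 0 < ρ q)
    (hρ0 : Tendsto ρ atTop (𝓝 0)) (hγ : 0 < γ) (hργ : ∀ q, γ * ρ q ≤ ρ (q + 1)) (hY : 0 < Y)
    (q₀ : ℕ) : ∃ c : ℝ, 0 < c ∧ ∀ H : ℕ, 1 ≤ H → ∃ q, q₀ ≤ q ∧
      Y * (2 * ρ q) ^ N * (H : ℝ) ^ (d + 1) < 1 ∧ c * psi (((d : ℝ) + 1) / N) H ≤ ρ q := by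
  classical
  have hN' : (0 : ℝ) < N := by exact_mod_cast hN
  let Y' : ℝ := Y ^ (1 / (N : ℝ))
  have hY' : 0 < Y' := Real.rpow_pos_of_pos hY _
  have hY'N : Y' ^ N = Y := by
    rw [← Real.rpow_natCast, ← Real.rpow_mul hY.le, one_div_mul_cancel hN'.ne', Real.rpow_one]
  refine ⟨min (ρ q₀) (γ / (2 * Y')), lt_min (hρ q₀) (by positivity), fun H hH => ?_⟩
  have hH' : (1 : ℝ) ≤ H := by exact_mod_cast hH
  have hex : ∃ q, q₀ ≤ q ∧ Y * (2 * ρ q) ^ N * (H : ℝ) ^ (d + 1) < 1 := by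
    have h1 : Tendsto (fun q => Y * (2 * ρ q) ^ N * (H : ℝ) ^ (d + 1)) atTop
        (𝓝 (Y * (2 * 0) ^ N * (H : ℝ) ^ (d + 1))) :=
      ((((hρ0.const_mul 2).pow N).const_mul Y).mul_const _)
    rw [mul_zero, zero_pow hN.ne', mul_zero, zero_mul] at h1
    exact ((eventually_ge_atTop q₀).and (h1.eventually (gt_mem_nhds one_pos))).exists
  obtain ⟨hq1, hq2⟩ := Nat.find_spec hex
  refine ⟨Nat.find hex, hq1, hq2, ?_⟩
  set q := Nat.find hex with hq
  have hpsi : 0 < psi (((d : ℝ) + 1) / N) H := by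
    rw [psi]
    have := Real.rpow_pos_of_pos (by linarith : (0 : ℝ) < H) (((d : ℝ) + 1) / N)
    positivity
  -- For the least admissible `q`, either it is `q₀`, or the cutoff fails at `q - 1`, which bounds
  -- `ρ (q - 1)`, hence `ρ q`, from below.
  rcases hq1.eq_or_lt with he | hlt
  · rw [← he]
    calc min (ρ q₀) (γ / (2 * Y')) * psi (((d : ℝ) + 1) / N) H ≤ ρ q₀ * 1 := by
          refine mul_le_mul (min_le_left _ _) (psi_le_one (by positivity) hH') hpsi.le (hρ q₀).le
      _ = ρ q₀ := mul_one _
  · obtain ⟨p, hp⟩ : ∃ p, q = p + 1 := ⟨q - 1, by omega⟩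
    have hnot := Nat.find_min hex (m := p) (by omega)
    have h1 : 1 ≤ Y * (2 * ρ p) ^ N * (H : ℝ) ^ (d + 1) := by
      by_contra! h
      exact hnot ⟨by omega, h⟩
    have h2 : ((H : ℝ) ^ (((d : ℝ) + 1) / N)) ^ N = (H : ℝ) ^ (d + 1) := by
      rw [← Real.rpow_natCast, ← Real.rpow_mul (by linarith), div_mul_cancel₀ _ hN'.ne',
        ← Real.rpow_natCast]
      push_cast
      rfl
    have hHc : 0 < (H : ℝ) ^ (((d : ℝ) + 1) / N) := Real.rpow_pos_of_pos (by linarith) _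
    have h3 : 1 ≤ Y' * (2 * ρ p) * (H : ℝ) ^ (((d : ℝ) + 1) / N) := by
      by_contra! h
      have h4 := pow_lt_one₀ (by have := hρ p; positivity) h hN.ne'
      rw [mul_pow, mul_pow, hY'N, h2] at h4
      linarith
    calc min (ρ q₀) (γ / (2 * Y')) * psi (((d : ℝ) + 1) / N) H
        ≤ γ / (2 * Y') * psi (((d : ℝ) + 1) / N) H := by
          gcongr
          exact min_le_right _ _
      _ ≤ γ * ρ p := by
          rw [psi, div_mul_div_comm, mul_one, div_le_iff₀ (by positivity)]
          calc γ = γ * 1 := (mul_one _).symm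
            _ ≤ γ * (Y' * (2 * ρ p) * (H : ℝ) ^ (((d : ℝ) + 1) / N)) := by gcongr
            _ = _ := by ring
      _ ≤ ρ q := by rw [hp]; exact hργ p

section Main

variable {k d : ℕ} {M : Set (Fin d → ℝ)} {U : Set (Fin k → ℝ)} {Ψ : (Fin k → ℝ) → (Fin d → ℝ)}

theorem IsLocalParam.mapsTo (hΨ : IsLocalParam M U Ψ) {v : Fin k → ℝ} (hv : v ∈ U) : Ψ v ∈ M := by
  obtain ⟨O, -, hO⟩ := hΨ.image_relatively_open
  exact (hO ▸ Set.mem_image_of_mem Ψ hv : Ψ v ∈ M ∩ O).1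

/-- A point is badly approximable if its parameter is far from the parameters of rational points. -/
theorem IsLocalParam.mem_BA (hΨ : IsLocalParam M U Ψ) {x : Fin k → ℝ} (hx : x ∈ U) {e c : ℝ}
    (he : 0 ≤ e) (hc : 0 < c) (h : ∀ (r : Fin d → ℚ), ∀ z ∈ U, Ψ z = ratPoint r →
      c * psi e (height r) ≤ ‖x - z‖) : Ψ x ∈ BA M (psi e) := by
  obtain ⟨A, hA0, hA⟩ := (hΨ.isBigO_sub_rev hx).exists_pos
  rw [isBigOWith_iff] at hA
  have h1 : Ψ '' {z | z ∈ U ∧ ‖z - x‖ ≤ A * ‖Ψ z - Ψ x‖} ∈ 𝓝[M] (Ψ x) := by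
    rw [← hΨ.map_nhds hx]
    exact image_mem_map (Filter.Eventually.and (hΨ.isOpen_domain.eventually_mem hx) hA)
  obtain ⟨η, hη, hη'⟩ := Metric.mem_nhdsWithin_iff.1 h1
  refine ⟨hΨ.mapsTo hx, min η (c / A), by positivity, fun r hr => ?_⟩
  have hH : (1 : ℝ) ≤ height r := by exact_mod_cast height_pos r
  have hpsi : 0 ≤ psi e (height r) := by
    rw [psi]
    positivity
  -- Far rational points are harmless as `psi ≤ 1`; near ones have a parameter `z` at which `Ψ`
  -- contracts distances to `x` by a bounded factor at most.
  rcases le_or_gt η (dist (Ψ x) (ratPoint r)) with hfar | hnear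
  · calc min η (c / A) * psi e (height r) ≤ η * 1 :=
          mul_le_mul (min_le_left _ _) (psi_le_one he hH) hpsi hη.le
      _ ≤ _ := by rwa [mul_one]
  · rw [dist_comm] at hnear
    obtain ⟨z, ⟨hzU, hz⟩, hzr⟩ := hη' ⟨hnear, hr⟩
    have h2 := h r z hzU hzr
    rw [dist_comm, ← hzr, dist_eq_norm]
    calc min η (c / A) * psi e (height r) ≤ c / A * psi e (height r) := by
          gcongr
          exact min_le_right _ _
      _ = c * psi e (height r) / A := by ring
      _ ≤ ‖Ψ z - Ψ x‖ := by
        rw [div_le_iff₀' hA0]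
        rw [norm_sub_rev] at h2
        exact h2.trans hz

/-- In each block of rounds Alice can force Bob to stay away from the rational points of suitably
bounded height. -/
theorem IsLocalParam.exists_force_avoid_rationals (hk : 1 ≤ k) (hd : 1 ≤ d)
    (hΨ : IsLocalParam M U Ψ) {D : ℕ} (hD : ∀ x ∈ M, IsNondegenerateAt k M D x)
    {K : Set (Fin k → ℝ)} (hK : IsCompact K) (hKU : K ⊆ U) {β : ℝ} (hβ : 0 < β) :
    ∃ (m : ℕ) (ε ρs Y : ℝ), 0 < m ∧ 0 < ε ∧ 0 < ρs ∧ 0 < Y ∧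
      ∀ B : (Fin k → ℝ) × ℝ, 0 < B.2 → Force β (fun B' => B'.2 ≤ B.2 / 2 ∧ (B.2 ≤ ρs →
        (K ∩ ballSet B).Nonempty → ∀ u ∈ ballSet B', ∀ r : Fin d → ℚ,
        ∀ z ∈ Metric.closedBall B.1 (2 * B.2), Ψ z = ratPoint r →
        Y * (2 * B.2) ^ Nkd k d * (height r : ℝ) ^ (d + 1) < 1 → ε * B.2 ≤ ‖u - z‖)) m B := by
  have hU := hΨ.isOpen_domain
  have hd0 : (0 : ℝ) < d := by exact_mod_cast hd
  let i₀ : Fin k := ⟨0, hk⟩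
  obtain ⟨δ₀, hδ₀, hδ₀U⟩ := hK.exists_cthickening_subset_open hU hKU
  have hK' : IsCompact (Metric.cthickening δ₀ K) := hK.cthickening
  obtain ⟨C, hC0, hC⟩ := exists_abs_pd_le hU hΨ.contDiffOn_apply hK' hδ₀U
    (max (D + 1) (nkd k d + 1))
  obtain ⟨δ, hδ, hδ'⟩ := hΨ.exists_le_sum_abs_pd hD hK' hδ₀U
  obtain ⟨Y, hY, hYH⟩ := exists_const_rational_points_on_hyperplane hk hd hU hΨ.contDiffOn C
  obtain ⟨m, ε, ρs, hε, hρs, hF⟩ := exists_force_avoid_zeros hβ i₀ D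
    (C := d * C) (by positivity) hδ
  -- The extra round halves the radius. The bound `1 / 2` gives `2 * B.2 ≤ 1`, and `δ₀ / 3` keeps
  -- the doubled ball within `δ₀` of `K`.
  refine ⟨m + 1, ε, min ρs (min (1 / 2) (δ₀ / 3)), Y, by omega, hε, by positivity, hY,
    fun B hB => ?_⟩
  have hshrink : ∀ {B' : (Fin k → ℝ) × ℝ}, 0 < B'.2 → ballSet B' ⊆ ballSet B →
      Force β (fun B'' => B''.2 ≤ B.2 / 2 ∧ ballSet B'' ⊆ ballSet B') 1 B' := fun {B'} hB' hsub =>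
    ((force_shrink i₀ 1 hB').and_bounds hβ hB').mono fun B'' h => ⟨h.1.trans (by
      have := radius_le_of_ballSet_subset i₀ hB' hsub
      rw [pow_one]
      linarith), h.2.1⟩
  refine Force.bind ?_
  by_cases hgood : B.2 ≤ min ρs (min (1 / 2) (δ₀ / 3)) ∧ (K ∩ ballSet B).Nonempty
  · obtain ⟨hBρ, y, hyK, hyB⟩ := hgood
    simp only [le_min_iff] at hBρ
    obtain ⟨hB1, hB2, hB3⟩ := hBρ
    have hBK' : Metric.closedBall B.1 (2 * B.2) ⊆ Metric.cthickening δ₀ K := by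
      intro v hv
      refine Metric.mem_cthickening_of_dist_le v y _ _ hyK ?_
      have h1 := Metric.mem_closedBall.1 hv
      have h2 := Metric.mem_closedBall'.1 hyB
      have h3 := dist_triangle v B.1 y
      linarith
    obtain ⟨b, a, ha, hab⟩ := hYH B.1 (2 * B.2) (by positivity) (by linarith)
      (hBK'.trans hδ₀U) fun u hu l s hs => hC l s (hs.trans (le_max_right _ _)) u (hBK' hu)
    have hpdf : ∀ s : List (Fin k), s ≠ [] → ∀ u ∈ Metric.closedBall B.1 (2 * B.2),
        pd s (fun v => b + ∑ l, a l * Ψ v l) u = ∑ l, a l * pd s (fun v => Ψ v l) u := by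
      intro s hs u hu
      rw [pd_affine hU hΨ.contDiffOn_apply a b s (hδ₀U (hBK' hu)), if_neg hs, zero_add]
    have hforce := hF U (fun v => b + ∑ l, a l * Ψ v l) B hU (hΨ.contDiffOn_affine a b) hB hB1
      (hBK'.trans hδ₀U) (fun u hu s hs hsD => ?_) (fun u hu => ?_)
    · refine (hforce.and_bounds hβ hB).mono ?_
      rintro B' ⟨h1, h2, -, h4⟩
      refine (hshrink h4 h2).mono ?_
      rintro B'' ⟨h5, h6⟩
      exact ⟨h5, fun _ _ u hu r z hz hzr hH => h1 u (h6 hu) z hz (hab r z hz hzr hH)⟩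
    · rw [hpdf s hs u hu]
      calc |∑ l, a l * pd s (fun v => Ψ v l) u| ≤ ∑ l : Fin d, 1 * C := by
            refine (Finset.abs_sum_le_sum_abs _ _).trans (Finset.sum_le_sum fun l _ => ?_)
            rw [abs_mul]
            exact mul_le_mul (ha ▸ norm_le_pi_norm a l)
              (hC l s (hsD.trans (le_max_left _ _)) u (hBK' hu)) (abs_nonneg _) zero_le_one
        _ = d * C := by simp
    · obtain ⟨s, hs0, hsD, hs⟩ := hδ' u (hBK' hu) a ha
      exact ⟨s, hs0, hsD, by rwa [hpdf s hs0 u hu]⟩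
  · refine ((force_shrink i₀ m hB).and_bounds hβ hB).mono ?_
    rintro B' ⟨-, h2, -, h4⟩
    exact (hshrink h4 h2).mono fun B'' h => ⟨h.1, fun h5 h6 => absurd ⟨h5, h6⟩ hgood⟩

/-- The points that are badly approximable by the rational points of a nondegenerate submanifold
form a hyperplane winning set relative to it. -/
theorem isHyperplaneWinningRel_BA {D : ℕ} (hk : 1 ≤ k) (hd : 1 ≤ d)
    (hD : ∀ x ∈ M, IsNondegenerateAt k M D x) :
    IsHyperplaneWinningRel k M (BA M (psi (cExp k d))) := by
  intro U Ψ hΨ K hK hKU β hβ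
  obtain ⟨m, ε, ρs, Y, hm, hε, hρs, hY, hF⟩ :=
    hΨ.exists_force_avoid_rationals hk hd hD hK hKU hβ
  obtain ⟨σ, hσ⟩ := exists_strategy_of_force ⟨0, hk⟩ hm hF
  refine ⟨σ, fun B hB => ?_⟩
  have hstep : ∀ n, ballSet (B (n + 1)) ⊆ ballSet (B n) := fun n u hu => ((hB.2 n).1 hu).1
  obtain ⟨x, hx⟩ : (⋂ n, ballSet (B n)).Nonempty :=
    IsCompact.nonempty_iInter_of_sequence_nonempty_isCompact_isClosed _ hstep
      (fun n => ⟨(B n).1, Metric.mem_closedBall_self (hB.1 n).le⟩) (isCompact_closedBall _ _)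
      fun n => Metric.isClosed_closedBall
  refine ⟨x, hx, ?_⟩
  by_cases hxK : x ∈ K
  swap
  · exact Or.inr hxK
  have hxB : ∀ n, x ∈ ballSet (B n) := Set.mem_iInter.1 hx
  refine Or.inl ⟨hKU hxK, ?_⟩
  let ρ : ℕ → ℝ := fun q => (B (m * q)).2
  have hρ : ∀ q, 0 < ρ q := fun q => hB.1 _
  have hhalf : ∀ q, ρ (q + 1) ≤ ρ q / 2 := fun q => (hσ B hB q).1
  have hργ : ∀ q, β ^ m * ρ q ≤ ρ (q + 1) := by
    intro q
    have h1 : ∀ j, β ^ j * ρ q ≤ (B (m * q + j)).2 := by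
      intro j
      induction j with
      | zero => simp [ρ]
      | succ j ih =>
        refine le_trans ?_ (hB.2 (m * q + j)).2
        rw [pow_succ', mul_assoc]
        gcongr
    exact h1 m
  have hgeom : ∀ q, ρ q ≤ ρ 0 * (1 / 2) ^ q := by
    intro q
    induction q with
    | zero => simp
    | succ q ih =>
      refine (hhalf q).trans ?_
      rw [pow_succ]
      linarith
  have hρ0 : Tendsto ρ atTop (𝓝 0) := by
    refine squeeze_zero (fun q => (hρ q).le) hgeom ?_
    simpa using (tendsto_pow_atTop_nhds_zero_of_lt_one (by norm_num : (0 : ℝ) ≤ 1 / 2)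
      (by norm_num)).const_mul (ρ 0)
  obtain ⟨q₀, hq₀⟩ := eventually_atTop.1 (hρ0.eventually (ge_mem_nhds hρs))
  have hN : 0 < Nkd k d := hd.trans (le_Nkd k d)
  obtain ⟨c, hc, hcH⟩ := exists_scale (d := d) hN hρ hρ0 (pow_pos hβ m) hργ hY q₀
  refine hΨ.mem_BA (hKU hxK) (e := cExp k d) (c := min ε 1 * c) (by rw [cExp]; positivity)
    (by positivity) fun r z _ hzr => ?_
  obtain ⟨q, hq, hqH, hqc⟩ := hcH (height r) (height_pos r)
  have h1 : min ε 1 * ρ q ≤ ‖x - z‖ := by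
    -- Outside the doubled ball, `z` is at distance at least the radius from `x` without any effort
    -- by Alice.
    by_cases hz : z ∈ Metric.closedBall (B (m * q)).1 (2 * (B (m * q)).2)
    · refine le_trans (mul_le_mul_of_nonneg_right (min_le_left _ _) (hρ q).le) ?_
      exact (hσ B hB q).2 (hq₀ q hq) ⟨x, hxK, hxB _⟩ x (hxB _) r z hz hzr hqH
    · refine le_trans (mul_le_mul_of_nonneg_right (min_le_right _ _) (hρ q).le) ?_
      rw [Metric.mem_closedBall, not_le] at hz
      have h2 := Metric.mem_closedBall.1 (hxB (m * q))
      have h3 := dist_triangle z x (B (m * q)).1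
      rw [dist_comm z x] at h3
      rw [one_mul, ← dist_eq_norm]
      change (B (m * q)).2 ≤ _
      linarith
  refine le_trans ?_ h1
  rw [mul_assoc]
  exact mul_le_mul_of_nonneg_left hqc (by positivity)

end Main

end IntrinsicApprox

theorem theorem4p2 (k d D : ℕ) (hk : 1 ≤ k) (hkd : k ≤ d) (M : Set (Fin d → ℝ))
    (hM : IntrinsicApprox.IsSubmanifold k M)
    (hD : ∀ x ∈ M, IntrinsicApprox.IsNondegenerateAt k M D x) :
    IntrinsicApprox.IsHyperplaneWinningRel k M
      (IntrinsicApprox.BA M (IntrinsicApprox.psi (IntrinsicApprox.cExp k d))) :=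
  IntrinsicApprox.isHyperplaneWinningRel_BA hk (hk.trans hkd) hD
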